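/- Let $\mathcal{C}$ be the class of open sets $\Omega\subset\mathbb{R}^3$ with $C^{1,1}$ boundary that are diffeomorphic to balls, in the sense that some $C^{1,1}$ diffeomorphism (with $C^{1,1}$ inverse) from a neighbourhood of the closed unit ball onto an open subset of $\mathbb{R}^3$ maps the open unit ball onto $\Omega$. For $\Omega\in\mathcal{C}$ let $V(\Omega)$ be its volume, let $H$ be the mean curvature of $\partial\Omega$ with respect to the outer unit normal (the arithmetic mean of the two principal curvatures, defined almost everywhere on $\partial\Omega$ and equal to $1/R$ on a sphere of radius $R$), let $L^p(\partial\Omega)$ be taken with respect to surface measure, and let $\Omega^*$ be a ball with $V(\Omega^*)=V(\Omega)$. 1. For every $2<p\le\infty$, $$\inf\left\{\|H\|_{L^p(\partial\Omega)} : \Omega\in\mathcal{C},\ V(\Omega)=1\right\}=0 .$$ 2. In particular, for every $2<p\le\infty$ there is $\Omega\in\mathcal{C}$ such that $$\|H\|_{L^p(\partial\Omega)}<\|H\|_{L^p(\partial\Omega^*)} .$$ 3. Consequently the question of Pankrashkin and Popoff, whether $\sup_{\partial\Omega}H\ge\sup_{\partial\Omega^*}H$ for every bounded domain $\Omega$ with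 connected (regular) boundary, has a negative answer for $C^{1,1}$ domains in $\mathbb{R}^3$: there is $\Omega\in\mathcal{C}$ (in particular bounded, connected, with connected boundary) such that $$\operatorname*{ess\,sup}_{\partial\Omega}H<\operatorname*{ess\,sup}_{\partial\Omega^*}H .$$ -/

import Mathlib

open MeasureTheory Filter Topology Metric
open scoped ENNReal

noncomputable section

/-- Euclidean three-space. -/
abbrev E3 : Type := EuclideanSpace ℝ (Fin 3)

/-- `f` is of class `C^{1,1}` on the open set `U`: it is differentiable there and its derivative is
locally Lipschitz on `U`. -/
def C11On {F : Type*} [NormedAddCommGroup F] [NormedSpace ℝ F] (f : E3 → F) (U : Set E3) : Prop :=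
  DifferentiableOn ℝ f U ∧ LocallyLipschitzOn U (fderiv ℝ f)

/-- `Ω` is open with boundary of class `C^{1,1}`: near each boundary point, `Ω` is the side
`{φ < 0}` of the zero set of a `C^{1,1}` function `φ` with non-vanishing gradient. (By the implicit
function theorem: `Ω` is locally the subgraph of a `C^{1,1}` function in a suitable orthonormal
frame. The condition forces `φ x = 0` at the boundary point `x`.) -/
def IsC11Domain (Ω : Set E3) : Prop :=
  IsOpen Ω ∧ ∀ x ∈ frontier Ω, ∃ r > 0, ∃ φ : E3 → ℝ,
    C11On φ (ball x r) ∧ (∀ y ∈ ball x r, fderiv ℝ φ y ≠ 0) ∧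
      ∀ y ∈ ball x r, (y ∈ Ω ↔ φ y < 0)

/-- `Ω` is diffeomorphic to the ball, up to the boundary: there is a `C^{1,1}` diffeomorphism
(with `C^{1,1}` inverse) from an open neighbourhood of the closed unit ball onto an open set of
`ℝ³` that maps the open unit ball onto `Ω`
(hence the closed ball onto the closure, and the unit sphere onto the boundary, of `Ω`). -/
def IsDiffeomorphicToBall (Ω : Set E3) : Prop :=
  ∃ Φ : OpenPartialHomeomorph E3 E3,
    closedBall (0 : E3) 1 ⊆ Φ.source ∧ C11On Φ Φ.source ∧ C11On Φ.symm Φ.target ∧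
      Φ '' ball (0 : E3) 1 = Ω

/-- The class of `C^{1,1}` domains in `ℝ³` that are diffeomorphic to balls. -/
def IsC11BallDomain (Ω : Set E3) : Prop :=
  IsC11Domain Ω ∧ IsDiffeomorphicToBall Ω

/-- The unit vector `ν` is the outer normal to `Ω` at `x`: to first order at `x`, `Ω` is the
half-space `{y | ⟪ν, y - x⟫ < 0}`. Such a vector is unique, see `IsOuterNormal.unique`. -/
def IsOuterNormal (Ω : Set E3) (x ν : E3) : Prop :=
  ‖ν‖ = 1 ∧ ∀ ε > 0, ∀ᶠ y in 𝓝 x,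
    (inner ℝ ν (y - x) < -(ε * ‖y - x‖) → y ∈ Ω) ∧
    (ε * ‖y - x‖ < inner ℝ ν (y - x) → y ∉ Ω)

theorem IsOuterNormal.unique {Ω : Set E3} {x ν μ : E3}
    (hν : IsOuterNormal Ω x ν) (hμ : IsOuterNormal Ω x μ) : ν = μ := by
  by_contra hne
  obtain ⟨h1, hν⟩ := hν
  obtain ⟨h2, hμ⟩ := hμ
  have hc : inner ℝ ν μ < 1 := (inner_lt_one_iff_real_of_norm_eq_one h1 h2).2 hne
  set w : E3 := ν - μ with hw
  have hwν : inner ℝ ν w = 1 - inner ℝ ν μ := by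
    rw [hw, inner_sub_right, real_inner_self_eq_norm_sq, h1]; norm_num
  have hwμ : inner ℝ μ w = -(1 - inner ℝ ν μ) := by
    rw [hw, inner_sub_right, real_inner_self_eq_norm_sq, h2, real_inner_comm]; norm_num
  set d := 1 - inner ℝ ν μ with hd
  have hdpos : 0 < d := by linarith
  have hwpos : 0 < ‖w‖ := norm_pos_iff.2 (sub_ne_zero.2 hne)
  have hε : 0 < d / (2 * ‖w‖) := by positivity
  have hlim : Tendsto (fun t : ℝ => x + t • w) (𝓝[>] 0) (𝓝 x) := by
    have : Tendsto (fun t : ℝ => x + t • w) (𝓝 0) (𝓝 (x + (0 : ℝ) • w)) := by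
      apply Continuous.tendsto; fun_prop
    rw [zero_smul, add_zero] at this
    exact this.mono_left nhdsWithin_le_nhds
  obtain ⟨t, ⟨ha, hb⟩, ht⟩ := (((hlim.eventually (hν _ hε)).and
    (hlim.eventually (hμ _ hε))).and self_mem_nhdsWithin).exists
  have ht : 0 < t := ht
  have hn : d / (2 * ‖w‖) * ‖x + t • w - x‖ = t * d / 2 := by
    rw [add_sub_cancel_left, norm_smul, Real.norm_of_nonneg ht.le]; field_simp
  rw [hn, add_sub_cancel_left, inner_smul_right, hwν] at ha
  rw [hn, add_sub_cancel_left, inner_smul_right, hwμ] at hb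
  have htd : 0 < t * d := mul_pos ht hdpos
  exact ha.2 (by linarith) (hb.1 (by linarith))

open Classical in
/-- The outer unit normal field of `Ω` (it is `0` at the points where there is no normal). -/
def outerNormal (Ω : Set E3) (x : E3) : E3 :=
  if h : ∃ ν, IsOuterNormal Ω x ν then h.choose else 0

/-- The mean curvature of `∂Ω` with respect to the outer normal `ν`, that is, the arithmetic mean
of the principal curvatures, `H = (div_{∂Ω} ν) / 2`: half the trace over the tangent plane
`ν(x)^⊥` of the derivative of `ν` along `∂Ω`. Derivatives of `ν` within `∂Ω` agree on the tangent
plane, so the value does not depend on which one is taken. For `C^{1,1}` domains `ν` is Lipschitz on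
`∂Ω`, so that it is differentiable along `∂Ω` at almost every point of `∂Ω`.
The sphere of radius `R` has `H = 1 / R`. -/
def meanCurvature (Ω : Set E3) (x : E3) : ℝ :=
  let L : E3 →L[ℝ] E3 := fderivWithin ℝ (outerNormal Ω) (frontier Ω) x
  (LinearMap.trace ℝ E3 L.toLinearMap - inner ℝ (outerNormal Ω x) (L (outerNormal Ω x))) / 2

/-- Surface measure on `∂Ω`: the two-dimensional Hausdorff measure (normalised so that it is the
Lebesgue measure on planes), restricted to `∂Ω`. -/
def surfaceMeasure (Ω : Set E3) : Measure E3 :=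
  (Measure.euclideanHausdorffMeasure 2 : Measure E3).restrict (frontier Ω)

/-- The norm `‖H‖_{L^p(∂Ω)}`, for `0 ≤ p ≤ ∞`. -/
def normH (p : ℝ≥0∞) (Ω : Set E3) : ℝ≥0∞ :=
  eLpNorm (meanCurvature Ω) p (surfaceMeasure Ω)

/-- The (essential) supremum of the signed mean curvature over `∂Ω`. -/
def supH (Ω : Set E3) : EReal :=
  essSup (fun x => (meanCurvature Ω x : EReal)) (surfaceMeasure Ω)

end

/-! A thin spherical shell of large radius has small volume and small curvature, but it is not a
ball: its boundary has two components. Cutting a hole at the north pole joins the two spheres by a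
neck and makes it a ball. The neck need not cost mean curvature, because a catenoid is minimal: its
two large principal curvatures cancel.

With t = log r - b and polar angle θ, `shell ε b` is the set ε cosh(t/ε) < 2 sin(θ/2), written as
the negativity set of `shellFun`, which is smooth off the origin. Near the pole 2 sin(θ/2) is close
to θ, so after division by e^b the boundary resembles a catenoid of neck radius ε. All points
satisfy |t| ≤ ε log(4/ε), which tends to 0 with ε.

Four facts carry the proof. In the divergence of the normalised gradient the leading catenoidal
terms cancel exactly (`shell_curvature_identity`), leaving |H| ≤ 2/r (`abs_meanCurvature_shell_le`).
Stereographic projection with a rescaled logarithm of r turns the shell into the unit ball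
(`shellFun_eq_norm_shellInv`). The volume is e^(3b) times a quantity tending to 0 with ε, so volume
1 is compatible with arbitrarily large e^b (`exists_shell_volume_eq_one`). The area is at most K
e^(2b) with K independent of ε (`exists_surfaceMeasure_shell_le`).

Hence ‖H‖_p is at most a constant times e^(b(2/p - 1)), which tends to 0 as e^b grows exactly
because p > 2. The ball of volume 1 has fixed positive curvature norm and supremum, so the
comparisons follow. -/

/-! ### Outer normals and curvature from a defining function -/

theorem ContDiffOn.c11On {F : Type*} [NormedAddCommGroup F] [NormedSpace ℝ F] {f : E3 → F}
    {U : Set E3} (hU : IsOpen U) (hf : ContDiffOn ℝ 2 f U) : C11On f U := by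
  refine ⟨hf.differentiableOn (by norm_num), fun x hx => ?_⟩
  have h1 : ContDiffAt ℝ 1 (fderiv ℝ f) x :=
    (hf.contDiffAt (hU.mem_nhds hx)).fderiv_right (by norm_num)
  obtain ⟨K, t, ht, hK⟩ := h1.exists_lipschitzOnWith
  exact ⟨K, t, mem_nhdsWithin_of_mem_nhds ht, hK⟩

theorem isOuterNormal_of_hasFDerivAt {Ω : Set E3} {G : E3 → ℝ} {x g : E3} (hG : G x = 0)
    (hg : g ≠ 0) (hd : HasFDerivAt G (innerSL ℝ g) x) (hΩ : ∀ᶠ y in 𝓝 x, (y ∈ Ω ↔ G y < 0)) :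
    IsOuterNormal Ω x (‖g‖⁻¹ • g) := by
  have hg0 : 0 < ‖g‖ := norm_pos_iff.2 hg
  refine ⟨by rw [norm_smul, norm_inv, norm_norm, inv_mul_cancel₀ hg0.ne'], fun ε hε => ?_⟩
  have ho := (hasFDerivAt_iff_isLittleO.1 hd).def (mul_pos hε hg0)
  filter_upwards [ho, hΩ] with y hy hyΩ
  rw [hG, sub_zero, innerSL_apply_apply, Real.norm_eq_abs, abs_le] at hy
  rw [hyΩ, inner_smul_left, RCLike.conj_to_real]
  have key : inner ℝ g (y - x) = ‖g‖ * (‖g‖⁻¹ * inner ℝ g (y - x)) := by field_simp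
  constructor
  · intro h
    have := mul_lt_mul_of_pos_left h hg0
    rw [← key] at this
    linarith [hy.2]
  · intro h
    have := mul_lt_mul_of_pos_left h hg0
    rw [← key] at this
    linarith [hy.1]

theorem IsOuterNormal.outerNormal_eq {Ω : Set E3} {x ν : E3} (h : IsOuterNormal Ω x ν) :
    outerNormal Ω x = ν := by
  have hex : ∃ ν, IsOuterNormal Ω x ν := ⟨ν, h⟩
  rw [outerNormal, dif_pos hex]
  exact hex.choose_spec.unique h

theorem exists_mem_segment_frontier {Ω : Set E3} {a b : E3} (ha : a ∈ Ω) (hb : b ∉ Ω) :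
    ∃ z ∈ segment ℝ a b, z ∈ frontier Ω := by
  have hp : IsPreconnected (segment ℝ a b) := (convex_segment a b).isPreconnected
  by_contra! hcon
  have hsub : segment ℝ a b ⊆ interior Ω ∪ (closure Ω)ᶜ := by
    intro z hz
    by_cases h1 : z ∈ interior Ω
    · exact Or.inl h1
    · exact Or.inr fun h2 => hcon z hz ⟨h2, h1⟩
  have haI : a ∈ interior Ω :=
    (hsub (left_mem_segment ℝ a b)).resolve_right fun h => h (subset_closure ha)
  have hbE : b ∈ (closure Ω)ᶜ :=
    (hsub (right_mem_segment ℝ a b)).resolve_left fun h => hb (interior_subset h)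
  obtain ⟨z, -, hz1, hz2⟩ := hp _ _ isOpen_interior isClosed_closure.isOpen_compl hsub
    ⟨a, left_mem_segment ℝ a b, haI⟩ ⟨b, right_mem_segment ℝ a b, hbE⟩
  exact hz2 (subset_closure (interior_subset hz1))

/-- The frontier approaches `x` in every direction orthogonal to the normal. -/
theorem IsOuterNormal.exists_frontier_near {Ω : Set E3} {x ν v : E3} (h : IsOuterNormal Ω x ν)
    (hv : inner ℝ ν v = 0) {η : ℝ} (hη : 0 < η) :
    ∀ᶠ s in 𝓝[>] (0 : ℝ), ∃ y ∈ frontier Ω, ‖y - x - s • v‖ ≤ η * s := by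
  have hlim : ∀ w : E3, Tendsto (fun s : ℝ => x + s • w) (𝓝[>] 0) (𝓝 x) := by
    intro w
    have : Tendsto (fun s : ℝ => x + s • w) (𝓝 0) (𝓝 (x + (0 : ℝ) • w)) := by
      apply Continuous.tendsto; fun_prop
    rw [zero_smul, add_zero] at this
    exact this.mono_left nhdsWithin_le_nhds
  have hνν : inner ℝ ν ν = (1 : ℝ) := by rw [real_inner_self_eq_norm_sq, h.1]; norm_num
  -- The points x + s(v ± ην) are at distance less than sM from x, while their normal components are
  -- ±sη. Slope η/M therefore puts one in Ω and the other outside, and the segment between them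
  -- meets the frontier.
  set M := ‖v‖ + η + 1 with hM
  have hMpos : 0 < M := by positivity
  have hbound : ∀ σ : ℝ, |σ| = 1 → ‖v + (σ * η) • ν‖ < M := by
    intro σ hσ
    refine (norm_add_le _ _).trans_lt ?_
    rw [norm_smul, h.1, Real.norm_eq_abs, abs_mul, hσ, abs_of_pos hη]; linarith
  filter_upwards [(hlim (v + ((-1) * η) • ν)).eventually (h.2 (η / M) (by positivity)),
    (hlim (v + (1 * η) • ν)).eventually (h.2 (η / M) (by positivity)), self_mem_nhdsWithin]
    with s hs1 hs2 hs
  have hs : 0 < s := hs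
  have hb : ∀ σ : ℝ, |σ| = 1 → η / M * ‖s • (v + (σ * η) • ν)‖ < s * η := by
    intro σ hσ
    rw [norm_smul, Real.norm_of_nonneg hs.le]
    calc η / M * (s * ‖v + (σ * η) • ν‖) < η / M * (s * M) := by
          gcongr; exact hbound σ hσ
      _ = s * η := by field_simp
  have h1 : x + s • (v + ((-1) * η) • ν) ∈ Ω := by
    apply hs1.1
    have := hb (-1) (by norm_num)
    rw [add_sub_cancel_left, inner_smul_right, inner_add_right, hv, inner_smul_right, hνν]
    linarith
  have h2 : x + s • (v + (1 * η) • ν) ∉ Ω := by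
    apply hs2.2
    have := hb 1 (by norm_num)
    rw [add_sub_cancel_left, inner_smul_right, inner_add_right, hv, inner_smul_right, hνν]
    linarith
  obtain ⟨z, hz, hzf⟩ := exists_mem_segment_frontier h1 h2
  refine ⟨z, hzf, ?_⟩
  have hconv : Convex ℝ (closedBall (x + s • v) (η * s)) := convex_closedBall _ _
  have hmem : ∀ σ : ℝ, |σ| = 1 → x + s • (v + (σ * η) • ν) ∈ closedBall (x + s • v) (η * s) := by
    intro σ hσ
    rw [mem_closedBall, dist_eq_norm,
      show x + s • (v + (σ * η) • ν) - (x + s • v) = (s * (σ * η)) • ν by module,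
      norm_smul, h.1, Real.norm_eq_abs, abs_mul, abs_mul, hσ, abs_of_pos hη, abs_of_pos hs]
    linarith
  have := hconv.segment_subset (hmem (-1) (by norm_num)) (hmem 1 (by norm_num)) hz
  rwa [mem_closedBall, dist_eq_norm, ← sub_sub] at this

/-- The difference of the two derivatives is a derivative of 0 along the frontier, and frontier
points approach x in every tangential direction, so it kills tangent vectors. This makes
`meanCurvature` independent of the choice hidden in `fderivWithin`. -/
theorem IsOuterNormal.hasFDerivWithinAt_eq_on_tangent {Ω : Set E3} {x ν v : E3}
    (h : IsOuterNormal Ω x ν) (hv : inner ℝ ν v = 0) {N : E3 → E3} {L L' : E3 →L[ℝ] E3}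
    (hL : HasFDerivWithinAt N L (frontier Ω) x) (hL' : HasFDerivWithinAt N L' (frontier Ω) x) :
    L v = L' v := by
  set D := L - L' with hD
  have hDo : HasFDerivWithinAt (fun _ : E3 => (0 : E3)) D (frontier Ω) x := by
    exact (hL.sub hL').congr (fun y _ => (sub_self _).symm) (sub_self _).symm
  suffices hDv : D v = 0 by
    rw [hD, sub_apply, sub_eq_zero] at hDv; exact hDv
  have hmain : ∀ η : ℝ, 0 < η → η < 1 → ‖D v‖ ≤ η * (‖v‖ + 1 + ‖D‖) := by
    intro η hη hη1
    have ho := (hasFDerivWithinAt_iff_isLittleO.1 hDo).def hη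
    rw [eventually_nhdsWithin_iff] at ho
    obtain ⟨δ, hδ, hball⟩ := Metric.eventually_nhds_iff.1 ho
    have hsmall : ∀ᶠ s in 𝓝[>] (0 : ℝ), s * (‖v‖ + 1) < δ := by
      have : Tendsto (fun s : ℝ => s * (‖v‖ + 1)) (𝓝 0) (𝓝 (0 * (‖v‖ + 1))) := by
        apply Continuous.tendsto; fun_prop
      rw [zero_mul] at this
      exact (this.mono_left nhdsWithin_le_nhds).eventually (gt_mem_nhds hδ)
    obtain ⟨s, ⟨⟨y, hyf, hy⟩, hsδ⟩, hs⟩ := (((h.exists_frontier_near hv hη).and hsmall).and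
      self_mem_nhdsWithin).exists
    have hs : 0 < s := hs
    have hyx : ‖y - x‖ ≤ s * (‖v‖ + 1) := by
      calc ‖y - x‖ = ‖(y - x - s • v) + s • v‖ := by rw [sub_add_cancel]
        _ ≤ η * s + s * ‖v‖ := (norm_add_le _ _).trans (by
            rw [norm_smul, Real.norm_of_nonneg hs.le]; gcongr)
        _ ≤ s * (‖v‖ + 1) := by nlinarith
    have h1 := hball (by rw [dist_eq_norm]; exact hyx.trans_lt hsδ) hyf
    simp only [sub_self, zero_sub, norm_neg] at h1
    have h2 : s * ‖D v‖ ≤ s * (η * (‖v‖ + 1 + ‖D‖)) := by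
      calc s * ‖D v‖ = ‖D (s • v)‖ := by
            rw [map_smul, norm_smul, Real.norm_of_nonneg hs.le]
        _ = ‖D (y - x) - D (y - x - s • v)‖ := by rw [← map_sub]; congr 2; abel
        _ ≤ η * (s * (‖v‖ + 1)) + ‖D‖ * (η * s) := by
            refine (norm_sub_le _ _).trans (add_le_add (h1.trans (by gcongr)) ?_)
            exact (D.le_opNorm _).trans (by gcongr)
        _ = s * (η * (‖v‖ + 1 + ‖D‖)) := by ring
    exact le_of_mul_le_mul_left h2 hs
  have hlim : Tendsto (fun η : ℝ => η * (‖v‖ + 1 + ‖D‖)) (𝓝[>] 0) (𝓝 0) := by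
    have : Tendsto (fun η : ℝ => η * (‖v‖ + 1 + ‖D‖)) (𝓝 0) (𝓝 (0 * (‖v‖ + 1 + ‖D‖))) := by
      apply Continuous.tendsto; fun_prop
    rw [zero_mul] at this
    exact this.mono_left nhdsWithin_le_nhds
  have hle : ‖D v‖ ≤ 0 := by
    refine ge_of_tendsto hlim ?_
    filter_upwards [Ioo_mem_nhdsGT (zero_lt_one' ℝ)] with η hη using hmain η hη.1 hη.2
  exact norm_le_zero_iff.1 hle

/-- The two maps differ by the rank-one map v ↦ ⟪ν, v⟫ (Lν - L'ν), whose trace is exactly its ν-ν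
entry. -/
theorem trace_sub_inner_eq_of_eq_on_orthogonal {ν : E3} (hν : ‖ν‖ = 1) {L L' : E3 →L[ℝ] E3}
    (h : ∀ v, inner ℝ ν v = 0 → L v = L' v) :
    LinearMap.trace ℝ E3 L.toLinearMap - inner ℝ ν (L ν) =
      LinearMap.trace ℝ E3 L'.toLinearMap - inner ℝ ν (L' ν) := by
  have hνν : inner ℝ ν ν = (1 : ℝ) := by rw [real_inner_self_eq_norm_sq, hν]; norm_num
  have hL : L.toLinearMap =
      L'.toLinearMap + (innerSL ℝ ν).toLinearMap.smulRight (L ν - L' ν) := by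
    ext1 v
    have hv := h (v - (inner ℝ ν v) • ν) (by
      rw [inner_sub_right, inner_smul_right, hνν]; ring)
    simp only [map_sub, map_smul] at hv
    simp only [LinearMap.add_apply, LinearMap.smulRight_apply, ContinuousLinearMap.coe_coe,
      innerSL_apply_apply]
    rw [smul_sub]
    rw [← sub_eq_zero] at hv ⊢
    rw [← hv]
    abel
  rw [hL, map_add, LinearMap.trace_smulRight]
  simp only [ContinuousLinearMap.coe_coe, innerSL_apply_apply, inner_sub_right]
  ring

theorem IsOuterNormal.meanCurvature_eq {Ω : Set E3} {x : E3} {N : E3 → E3} {L : E3 →L[ℝ] E3}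
    (hx : x ∈ frontier Ω) (h : IsOuterNormal Ω x (N x))
    (hN : ∀ y ∈ frontier Ω, outerNormal Ω y = N y) (hL : HasFDerivAt N L x) :
    meanCurvature Ω x = (LinearMap.trace ℝ E3 L.toLinearMap - inner ℝ (N x) (L (N x))) / 2 := by
  have hd : HasFDerivWithinAt (outerNormal Ω) L (frontier Ω) x :=
    hL.hasFDerivWithinAt.congr hN (hN x hx)
  have hdw := hd.differentiableWithinAt.hasFDerivWithinAt
  rw [meanCurvature]
  simp only [h.outerNormal_eq]
  rw [trace_sub_inner_eq_of_eq_on_orthogonal h.1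
    fun v hv => h.hasFDerivWithinAt_eq_on_tangent hv hdw hd]

/-- The divergence of the normalisation of a vector field `g` with derivative `B`. -/
theorem IsOuterNormal.meanCurvature_eq_of_field {Ω : Set E3} {x : E3} {g : E3 → E3}
    {B : E3 →L[ℝ] E3} (hx : x ∈ frontier Ω) (hg : g x ≠ 0)
    (hN : ∀ y ∈ frontier Ω, IsOuterNormal Ω y (‖g y‖⁻¹ • g y)) (hB : HasFDerivAt g B x) :
    meanCurvature Ω x = (LinearMap.trace ℝ E3 B.toLinearMap / ‖g x‖ -
      inner ℝ (g x) (B (g x)) / ‖g x‖ ^ 3) / 2 := by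
  have hg0 : 0 < ‖g x‖ := norm_pos_iff.2 hg
  have hinv : HasFDerivAt (fun y => ‖g y‖⁻¹)
      ((-(‖g x‖ ^ 3)⁻¹) • (innerSL ℝ (g x)).comp B) x := by
    have h1 : HasFDerivAt (fun y => ‖g y‖ ^ 2) (2 • (innerSL ℝ (g x)).comp B) x := hB.norm_sq
    have h2 : HasFDerivAt (fun y => Real.sqrt (‖g y‖ ^ 2))
        ((1 / (2 * Real.sqrt (‖g x‖ ^ 2))) • (2 • (innerSL ℝ (g x)).comp B)) x :=
      h1.sqrt (by positivity)
    simp only [Real.sqrt_sq (norm_nonneg _)] at h2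
    have h3 := (hasDerivAt_inv hg0.ne').comp_hasFDerivAt x h2
    refine h3.congr_fderiv ?_
    ext v
    simp only [smul_apply, smul_eq_mul, nsmul_eq_mul,
      ContinuousLinearMap.comp_apply]
    field_simp
    simp
  have hL := hinv.smul hB
  rw [IsOuterNormal.meanCurvature_eq (N := fun y => ‖g y‖⁻¹ • g y) hx (hN x hx)
    (fun y hy => (hN y hy).outerNormal_eq) hL]
  have hcoe : ((‖g x‖⁻¹ • B +
      ContinuousLinearMap.smulRight ((-(‖g x‖ ^ 3)⁻¹) • (innerSL ℝ (g x)).comp B) (g x) :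
        E3 →L[ℝ] E3)).toLinearMap = ‖g x‖⁻¹ • B.toLinearMap +
      LinearMap.smulRight ((-(‖g x‖ ^ 3)⁻¹) • (innerSL ℝ (g x)).comp B).toLinearMap (g x) := by
    ext v; simp
  rw [hcoe, map_add, map_smul, LinearMap.trace_smulRight]
  simp only [ContinuousLinearMap.coe_coe, add_apply,
    smul_apply, ContinuousLinearMap.smulRight_apply,
    ContinuousLinearMap.comp_apply, innerSL_apply_apply, inner_smul_left, inner_smul_right,
    inner_add_right, map_smul, smul_eq_mul, real_inner_self_eq_norm_sq, RCLike.conj_to_real]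
  field_simp
  ring

/-! ### Rotationally symmetric defining functions -/

/-- The axis of revolution. -/
noncomputable def axis : E3 := EuclideanSpace.single 2 1

theorem inner_axis (X : E3) : inner ℝ axis X = X 2 := by
  simp [axis, EuclideanSpace.inner_single_left]

theorem norm_axis : ‖axis‖ = 1 := by simp [axis]

theorem hasFDerivAt_norm_of_ne_zero {X : E3} (hX : X ≠ 0) :
    HasFDerivAt (fun Y : E3 => ‖Y‖) (‖X‖⁻¹ • innerSL ℝ X) X := by
  have hX0 : 0 < ‖X‖ := norm_pos_iff.2 hX
  have h2 : HasFDerivAt (fun y : E3 => Real.sqrt (‖y‖ ^ 2))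
      ((1 / (2 * Real.sqrt (‖X‖ ^ 2))) • (2 • innerSL ℝ X)) X :=
    (hasStrictFDerivAt_norm_sq X).hasFDerivAt.sqrt (by positivity)
  simp only [Real.sqrt_sq (norm_nonneg _)] at h2
  refine h2.congr_fderiv ?_
  ext v
  simp only [smul_apply, smul_eq_mul, nsmul_eq_mul]
  field_simp
  simp

/-- Writing the radial derivative as ψ‖X‖ makes the gradient ψX plus a constant vector, the shape of
field that `meanCurvature_radial` handles. -/
theorem hasFDerivAt_radial_add_axial {p : ℝ → ℝ} {X : E3} {c ψ : ℝ} (hX : X ≠ 0)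
    (hp : HasDerivAt p (ψ * ‖X‖) ‖X‖) :
    HasFDerivAt (fun Y : E3 => p ‖Y‖ + c * Y 2) (innerSL ℝ (ψ • X + c • axis)) X := by
  have hX0 : 0 < ‖X‖ := norm_pos_iff.2 hX
  have h1 := hp.comp_hasFDerivAt X (hasFDerivAt_norm_of_ne_zero hX)
  have h2 : HasFDerivAt (fun Y : E3 => c * inner ℝ axis Y) (c • innerSL ℝ axis) X :=
    (innerSL ℝ axis).hasFDerivAt.const_mul c
  simp only [inner_axis] at h2
  refine (h1.add h2).congr_fderiv ?_
  ext v
  simp only [smul_apply, add_apply, smul_eq_mul, innerSL_apply_apply, inner_add_left,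
    inner_smul_left, RCLike.conj_to_real]
  field_simp

theorem hasFDerivAt_radial_smul {ψ : ℝ → ℝ} {X : E3} {ψ' : ℝ} (v : E3) (hX : X ≠ 0)
    (hψ : HasDerivAt ψ ψ' ‖X‖) :
    HasFDerivAt (fun Y : E3 => ψ ‖Y‖ • Y + v) (ψ ‖X‖ • ContinuousLinearMap.id ℝ E3 +
      ContinuousLinearMap.smulRight ((ψ' / ‖X‖) • innerSL ℝ X) X) X := by
  have h1 := hψ.comp_hasFDerivAt X (hasFDerivAt_norm_of_ne_zero hX)
  refine ((h1.smul (hasFDerivAt_id X)).add_const v).congr_fderiv ?_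
  ext1 w
  simp only [smul_apply, add_apply, ContinuousLinearMap.smulRight_apply, Function.comp, smul_smul,
    id, ContinuousLinearMap.id_apply, div_eq_mul_inv]

/-- The mean curvature when the normal is proportional to a field `ψ(|X|) X + v`. -/
theorem meanCurvature_radial {Ω : Set E3} {ψ : ℝ → ℝ} {X v : E3} {ψ' : ℝ} (hx : X ∈ frontier Ω)
    (hX : X ≠ 0) (hψ : HasDerivAt ψ ψ' ‖X‖) (hg : ψ ‖X‖ • X + v ≠ 0)
    (hN : ∀ Y ∈ frontier Ω, IsOuterNormal Ω Y (‖ψ ‖Y‖ • Y + v‖⁻¹ • (ψ ‖Y‖ • Y + v))) :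
    meanCurvature Ω X = ((3 * ψ ‖X‖ + ψ' * ‖X‖) / ‖ψ ‖X‖ • X + v‖ -
      (ψ ‖X‖ * ‖ψ ‖X‖ • X + v‖ ^ 2 + ψ' / ‖X‖ * inner ℝ X (ψ ‖X‖ • X + v) ^ 2) /
        ‖ψ ‖X‖ • X + v‖ ^ 3) / 2 := by
  have hX0 : 0 < ‖X‖ := norm_pos_iff.2 hX
  rw [IsOuterNormal.meanCurvature_eq_of_field (g := fun Y => ψ ‖Y‖ • Y + v) hx hg hN
    (hasFDerivAt_radial_smul v hX hψ)]
  have hcoe : (ψ ‖X‖ • ContinuousLinearMap.id ℝ E3 +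
      ContinuousLinearMap.smulRight ((ψ' / ‖X‖) • innerSL ℝ X) X).toLinearMap =
      ψ ‖X‖ • LinearMap.id +
        LinearMap.smulRight ((ψ' / ‖X‖) • innerSL ℝ X).toLinearMap X := by
    ext w; simp
  rw [hcoe, map_add, map_smul, LinearMap.trace_smulRight, LinearMap.trace_id]
  set g := ψ ‖X‖ • X + v with hgdef
  simp only [ContinuousLinearMap.coe_coe, add_apply, smul_apply,
    ContinuousLinearMap.smulRight_apply, ContinuousLinearMap.id_apply, innerSL_apply_apply,
    inner_smul_right, inner_add_right, smul_eq_mul, real_inner_self_eq_norm_sq,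
    finrank_euclideanSpace_fin, real_inner_comm X g]
  congr 2
  · congr 1
    push_cast
    field_simp
  · congr 1
    ring

/-! ### Curvature of the ball -/

theorem isOuterNormal_ball {R : ℝ} (hR : 0 < R) {Y : E3} (hY : Y ∈ sphere (0 : E3) R) :
    IsOuterNormal (ball 0 R) Y (‖(1 : ℝ) • Y + (0 : E3)‖⁻¹ • ((1 : ℝ) • Y + 0)) := by
  have hn : ‖Y‖ = R := mem_sphere_zero_iff_norm.1 hY
  have hY0 : Y ≠ 0 := norm_pos_iff.1 (hn ▸ hR)
  have hp : HasDerivAt (fun r : ℝ => (r ^ 2 - R ^ 2) / 2) (1 * ‖Y‖) ‖Y‖ := by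
    have := (((hasDerivAt_id ‖Y‖).pow 2).sub_const (R ^ 2)).div_const 2
    refine this.congr_deriv ?_
    simp
  have hd := hasFDerivAt_radial_add_axial (c := 0) hY0 hp
  rw [zero_smul] at hd
  refine isOuterNormal_of_hasFDerivAt ?_ (by simpa using hY0) hd (Eventually.of_forall fun y => ?_)
  · simp [hn]
  · rw [mem_ball_zero_iff, ← sq_lt_sq₀ (norm_nonneg y) hR.le]
    constructor <;> intro h <;> linarith

theorem meanCurvature_ball {R : ℝ} (hR : 0 < R) {X : E3} (hX : X ∈ sphere (0 : E3) R) :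
    meanCurvature (ball 0 R) X = 1 / R := by
  have hn : ‖X‖ = R := mem_sphere_zero_iff_norm.1 hX
  have hX0 : X ≠ 0 := norm_pos_iff.1 (hn ▸ hR)
  have hfr : frontier (ball (0 : E3) R) = sphere 0 R := frontier_ball 0 hR.ne'
  rw [meanCurvature_radial (ψ := fun _ => 1) (v := 0) (hfr ▸ hX) hX0 (hasDerivAt_const _ _)
    (by simpa using hX0) (fun Y hY => isOuterNormal_ball hR (hfr ▸ hY))]
  simp only [one_smul, add_zero, hn]
  field_simp
  ring

/-! ### The catenoidal shell and its curvature -/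

/-- The function whose negativity set is the spherical shell with a catenoidal hole. -/
noncomputable def shellFun (ε b : ℝ) (X : E3) : ℝ :=
  ‖X‖ * (ε ^ 2 * Real.cosh ((Real.log ‖X‖ - b) / ε) ^ 2 - 2) + 2 * X 2

/-- A thin spherical shell of radius `exp b` with a small catenoidal hole at the north pole. -/
def shell (ε b : ℝ) : Set E3 := {X | X ≠ 0 ∧ shellFun ε b X < 0}

/-- The radial coefficient of the gradient of `shellFun`. -/
noncomputable def shellCoeff (ε b r : ℝ) : ℝ :=
  (ε ^ 2 * Real.cosh ((Real.log r - b) / ε) ^ 2 +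
    2 * ε * Real.cosh ((Real.log r - b) / ε) * Real.sinh ((Real.log r - b) / ε) - 2) / r

theorem hasDerivAt_log_sub_div {ε b r : ℝ} (hr : r ≠ 0) :
    HasDerivAt (fun r => (Real.log r - b) / ε) (r⁻¹ / ε) r :=
  ((Real.hasDerivAt_log hr).sub_const b).div_const ε

theorem hasDerivAt_shellProfile {ε b r : ℝ} (hr : r ≠ 0) :
    HasDerivAt (fun r => r * (ε ^ 2 * Real.cosh ((Real.log r - b) / ε) ^ 2 - 2))
      (shellCoeff ε b r * r) r := by
  have h := (hasDerivAt_id r).mul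
    ((((hasDerivAt_log_sub_div (ε := ε) (b := b) hr).cosh.pow 2).const_mul (ε ^ 2)).sub_const 2)
  refine h.congr_deriv ?_
  simp only [shellCoeff, id, Pi.pow_apply]
  field_simp
  push_cast
  ring

theorem hasDerivAt_shellCoeff {ε b r : ℝ} (hε : ε ≠ 0) (hr : r ≠ 0) :
    HasDerivAt (shellCoeff ε b) ((2 * (2 * Real.cosh ((Real.log r - b) / ε) ^ 2 - 1) -
      ε ^ 2 * Real.cosh ((Real.log r - b) / ε) ^ 2 + 2) / r ^ 2) r := by
  have hτ := hasDerivAt_log_sub_div (ε := ε) (b := b) hr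
  have h := ((((hτ.cosh.pow 2).const_mul (ε ^ 2)).add
    ((hτ.cosh.const_mul (2 * ε)).mul hτ.sinh)).sub_const 2).div (hasDerivAt_id r) hr
  refine h.congr_deriv ?_
  have hcs := Real.cosh_sq ((Real.log r - b) / ε)
  simp only [id, Pi.pow_apply, Pi.add_apply, Pi.mul_apply]
  field_simp
  push_cast
  linear_combination (-2) * hcs

theorem hasFDerivAt_shellFun {ε b : ℝ} {X : E3} (hX : X ≠ 0) :
    HasFDerivAt (shellFun ε b)
      (innerSL ℝ (shellCoeff ε b ‖X‖ • X + (2 : ℝ) • axis)) X :=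
  hasFDerivAt_radial_add_axial (c := 2) hX
    (hasDerivAt_shellProfile (norm_ne_zero_iff.2 hX))

/-- With A(t) = ε² cosh²(t/ε), the equation r(A - 2) + 2z = 0 eliminates z, and only r A'(t)
survives. -/
theorem inner_shellGrad {ε b : ℝ} {X : E3} (hX : X ≠ 0) (h0 : shellFun ε b X = 0) :
    inner ℝ X (shellCoeff ε b ‖X‖ • X + (2 : ℝ) • axis) =
      ‖X‖ * (2 * ε * Real.cosh ((Real.log ‖X‖ - b) / ε) *
        Real.sinh ((Real.log ‖X‖ - b) / ε)) := by
  have hX0 : 0 < ‖X‖ := norm_pos_iff.2 hX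
  rw [inner_add_right, inner_smul_right, inner_smul_right, real_inner_self_eq_norm_sq,
    real_inner_comm, inner_axis]
  rw [shellFun] at h0
  rw [shellCoeff]
  field_simp
  linear_combination h0

/-- Eliminating z by the boundary equation gives A'² + 4A - A², and cosh² - sinh² = 1 collapses this
to a multiple of cosh⁴. -/
theorem norm_sq_shellGrad {ε b : ℝ} {X : E3} (hX : X ≠ 0) (h0 : shellFun ε b X = 0) :
    ‖shellCoeff ε b ‖X‖ • X + (2 : ℝ) • axis‖ ^ 2 =
      4 * ε ^ 2 * Real.cosh ((Real.log ‖X‖ - b) / ε) ^ 4 * (1 - ε ^ 2 / 4) := by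
  have hX0 : 0 < ‖X‖ := norm_pos_iff.2 hX
  have hcs := Real.cosh_sq ((Real.log ‖X‖ - b) / ε)
  rw [norm_add_sq_real, norm_smul, norm_smul, norm_axis, inner_smul_left, inner_smul_right,
    RCLike.conj_to_real, real_inner_comm, inner_axis, mul_pow, Real.norm_eq_abs, sq_abs]
  have hz : X 2 = -(‖X‖ * (ε ^ 2 * Real.cosh ((Real.log ‖X‖ - b) / ε) ^ 2 - 2)) / 2 := by
    rw [shellFun] at h0; linarith
  rw [hz, shellCoeff]
  set c := Real.cosh ((Real.log ‖X‖ - b) / ε)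
  set s := Real.sinh ((Real.log ‖X‖ - b) / ε)
  norm_num
  field_simp
  linear_combination (-4 * ε ^ 2 * c ^ 2) * hcs

/-- Since z ≥ -r, the inequality forces A - 2 ≤ 2. Equality is possible only at the south pole, the
thickest point of the shell. -/
theorem shellFun_bound {ε b : ℝ} {X : E3} (hX : X ≠ 0) (h0 : shellFun ε b X ≤ 0) :
    ε ^ 2 * Real.cosh ((Real.log ‖X‖ - b) / ε) ^ 2 ≤ 4 := by
  have hX0 : 0 < ‖X‖ := norm_pos_iff.2 hX
  have hz : -‖X‖ ≤ X 2 := by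
    have := abs_real_inner_le_norm axis X
    rw [inner_axis, norm_axis, one_mul] at this
    exact (abs_le.1 this).1
  rw [shellFun] at h0
  by_contra! hcon
  nlinarith

theorem norm_shellGrad_lower {ε b : ℝ} (hε : 0 < ε) (hε1 : ε ≤ 1) {X : E3} (hX : X ≠ 0)
    (h0 : shellFun ε b X = 0) :
    ε * Real.cosh ((Real.log ‖X‖ - b) / ε) ^ 2 ≤
      ‖shellCoeff ε b ‖X‖ • X + (2 : ℝ) • axis‖ := by
  refine le_of_pow_le_pow_left₀ two_ne_zero (norm_nonneg _) ?_
  rw [norm_sq_shellGrad hX h0]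
  have : 0 ≤ ε ^ 2 * Real.cosh ((Real.log ‖X‖ - b) / ε) ^ 4 := by positivity
  have hε2 : 0 ≤ 1 - ε ^ 2 := by nlinarith
  nlinarith [mul_nonneg this hε2]

theorem shellGrad_ne_zero {ε b : ℝ} (hε : 0 < ε) (hε1 : ε ≤ 1) {X : E3} (hX : X ≠ 0)
    (h0 : shellFun ε b X = 0) : shellCoeff ε b ‖X‖ • X + (2 : ℝ) • axis ≠ 0 := by
  have := norm_shellGrad_lower hε hε1 hX h0
  have hc := Real.cosh_pos ((Real.log ‖X‖ - b) / ε)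
  exact norm_pos_iff.1 (lt_of_lt_of_le (by positivity) this)

theorem isOuterNormal_shell {ε b : ℝ} (hε : 0 < ε) (hε1 : ε ≤ 1) {X : E3} (hX : X ≠ 0)
    (h0 : shellFun ε b X = 0) :
    IsOuterNormal (shell ε b) X (‖shellCoeff ε b ‖X‖ • X + (2 : ℝ) • axis‖⁻¹ •
      (shellCoeff ε b ‖X‖ • X + (2 : ℝ) • axis)) := by
  refine isOuterNormal_of_hasFDerivAt h0 (shellGrad_ne_zero hε hε1 hX h0)
    (hasFDerivAt_shellFun hX) ?_
  filter_upwards [isOpen_ne.mem_nhds hX] with y hy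
  exact ⟨fun h => h.2, fun h => ⟨hy, h⟩⟩

/-- With `c = cosh τ`, `s = sinh τ` and `n` the length of the gradient, the numerator of the mean
curvature collapses to `2 A' n² + 4 ε⁴ c⁶ (1 - ε² / 4)`, where `A' = 2 ε c s`. -/
theorem shell_curvature_identity {ε c s n : ℝ} (hcs : c ^ 2 = s ^ 2 + 1)
    (hn : n ^ 2 = 4 * ε ^ 2 * c ^ 4 * (1 - ε ^ 2 / 4)) :
    (ε ^ 2 * c ^ 2 + 2 * (2 * ε * c * s) + 2 * (2 * c ^ 2 - 1) - 2) * n ^ 2 -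
      (2 * (2 * c ^ 2 - 1) - ε ^ 2 * c ^ 2 + 2) * (2 * ε * c * s) ^ 2 =
    2 * (2 * ε * c * s) * n ^ 2 + 4 * ε ^ 4 * c ^ 6 * (1 - ε ^ 2 / 4) := by
  have hs : s ^ 2 = c ^ 2 - 1 := by linarith
  rw [mul_pow, hs, hn]
  ring

/-- The bound ε²c² ≤ 4 is precisely what gives |A'| ≤ n, so the first term is at most 2n³. The
remainder equals (ε · εc²) n², hence is at most n³ because εc² ≤ n and ε ≤ 1. -/
theorem shell_curvature_bound {ε c s n : ℝ} (hε : 0 < ε) (hε1 : ε ≤ 1) (hc : 0 < c)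
    (hcs : c ^ 2 = s ^ 2 + 1) (hA : ε ^ 2 * c ^ 2 ≤ 4)
    (hn : n ^ 2 = 4 * ε ^ 2 * c ^ 4 * (1 - ε ^ 2 / 4)) (hn0 : ε * c ^ 2 ≤ n) :
    |2 * (2 * ε * c * s) * n ^ 2 + 4 * ε ^ 4 * c ^ 6 * (1 - ε ^ 2 / 4)| ≤ 4 * n ^ 3 := by
  have hnpos : 0 < n := lt_of_lt_of_le (by positivity) hn0
  have hk : 0 ≤ 1 - ε ^ 2 / 4 := by nlinarith
  have hA' : |2 * ε * c * s| ≤ n := by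
    refine abs_le_of_sq_le_sq ?_ hnpos.le
    have hs : s ^ 2 = c ^ 2 - 1 := by linarith
    rw [mul_pow, hs, hn]
    nlinarith [mul_nonneg (by positivity : 0 ≤ ε ^ 2 * c ^ 2) (sub_nonneg.2 hA)]
  have h2 : 4 * ε ^ 4 * c ^ 6 * (1 - ε ^ 2 / 4) ≤ n ^ 3 := by
    calc 4 * ε ^ 4 * c ^ 6 * (1 - ε ^ 2 / 4) = (ε * c) ^ 2 * ε * ε * (4 * c ^ 4 * (1 - ε ^ 2 / 4))
        := by ring
      _ = ε * (ε * c ^ 2) * (4 * ε ^ 2 * c ^ 4 * (1 - ε ^ 2 / 4)) := by ring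
      _ ≤ 1 * n * n ^ 2 := by rw [hn]; gcongr
      _ = n ^ 3 := by ring
  have h3 : 0 ≤ 4 * ε ^ 4 * c ^ 6 * (1 - ε ^ 2 / 4) := by positivity
  calc _ ≤ |2 * (2 * ε * c * s) * n ^ 2| + |4 * ε ^ 4 * c ^ 6 * (1 - ε ^ 2 / 4)| := abs_add_le _ _
    _ ≤ 2 * n * n ^ 2 + n ^ 3 := by
        rw [abs_mul, abs_mul, abs_of_nonneg h3, abs_of_pos (by positivity : 0 < n ^ 2), abs_two]
        gcongr
    _ ≤ 4 * n ^ 3 := by nlinarith [pow_pos hnpos 3]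

theorem abs_meanCurvature_shell_le {ε b : ℝ} (hε : 0 < ε) (hε1 : ε ≤ 1)
    (hfr : frontier (shell ε b) ⊆ {X | X ≠ 0 ∧ shellFun ε b X = 0}) {X : E3}
    (hX : X ∈ frontier (shell ε b)) : |meanCurvature (shell ε b) X| ≤ 2 / ‖X‖ := by
  obtain ⟨hX0, h0⟩ := hfr hX
  have hr : 0 < ‖X‖ := norm_pos_iff.2 hX0
  rw [meanCurvature_radial (ψ := shellCoeff ε b) (v := (2 : ℝ) • axis) hX hX0
    (hasDerivAt_shellCoeff hε.ne' hr.ne') (shellGrad_ne_zero hε hε1 hX0 h0)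
    (fun Y hY => isOuterNormal_shell hε hε1 (hfr hY).1 (hfr hY).2), inner_shellGrad hX0 h0]
  have hlow := norm_shellGrad_lower hε hε1 hX0 h0
  have hsq := norm_sq_shellGrad hX0 h0
  have hA := shellFun_bound hX0 h0.le
  have hcs := Real.cosh_sq ((Real.log ‖X‖ - b) / ε)
  have hc := Real.cosh_pos ((Real.log ‖X‖ - b) / ε)
  set n := ‖shellCoeff ε b ‖X‖ • X + (2 : ℝ) • axis‖
  rw [shellCoeff]
  set c := Real.cosh ((Real.log ‖X‖ - b) / ε)
  set s := Real.sinh ((Real.log ‖X‖ - b) / ε)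
  have hnpos : 0 < n := lt_of_lt_of_le (by positivity) hlow
  have hbd := shell_curvature_bound hε hε1 hc hcs hA hsq hlow
  rw [← shell_curvature_identity hcs hsq] at hbd
  -- Clearing the denominator 2n³‖X‖ turns the curvature into the numerator of
  -- `shell_curvature_identity`.
  rw [← mul_le_mul_iff_of_pos_right (by positivity : 0 < 2 * n ^ 3 * ‖X‖),
    ← abs_of_pos (by positivity : 0 < 2 * n ^ 3 * ‖X‖), ← abs_mul]
  rw [abs_of_pos (by positivity : 0 < 2 * n ^ 3 * ‖X‖),
    show 2 / ‖X‖ * (2 * n ^ 3 * ‖X‖) = 4 * n ^ 3 by field_simp; ring]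
  refine le_of_eq_of_le ?_ hbd
  congr 1
  field_simp
  ring

/-! ### A global chart taking the unit ball to the shell -/

/-- The complement of the upper half of the axis. -/
def slitSpace : Set E3 := {X | 0 < ‖X‖ - X 2}

/-- A diffeomorphism from the whole space to `slitSpace`: stereographic projection in the horizontal
variables, and a rescaled logarithm of the radius in the vertical one. -/
noncomputable def shellMap (ε b m : ℝ) (p : E3) : E3 :=
  let S := 1 + (m * p 0) ^ 2 + (m * p 1) ^ 2
  let T := Real.exp (b + ε * Real.arsinh (m * p 2 / √S)) / S
  !₂[T * (2 * (m * p 0)), T * (2 * (m * p 1)), T * (S - 2)]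

/-- The inverse of `shellMap`. -/
noncomputable def shellInv (ε b m : ℝ) (X : E3) : E3 :=
  !₂[X 0 / (‖X‖ - X 2) / m, X 1 / (‖X‖ - X 2) / m,
    Real.sinh ((Real.log ‖X‖ - b) / ε) * √(2 * ‖X‖ / (‖X‖ - X 2)) / m]

theorem norm_sq_E3 (X : E3) : ‖X‖ ^ 2 = X 0 ^ 2 + X 1 ^ 2 + X 2 ^ 2 := by
  rw [EuclideanSpace.norm_sq_eq, Fin.sum_univ_three]
  simp only [Real.norm_eq_abs, sq_abs]

theorem isOpen_slitSpace : IsOpen slitSpace :=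
  isOpen_lt continuous_const (by fun_prop)

theorem ne_zero_of_mem_slitSpace {X : E3} (hX : X ∈ slitSpace) : X ≠ 0 := by
  rintro rfl
  simp [slitSpace] at hX

theorem norm_shellMap (ε b m : ℝ) (p : E3) :
    ‖shellMap ε b m p‖ =
      Real.exp (b + ε * Real.arsinh (m * p 2 / √(1 + (m * p 0) ^ 2 + (m * p 1) ^ 2))) := by
  have hS : 0 < 1 + (m * p 0) ^ 2 + (m * p 1) ^ 2 := by positivity
  rw [← sq_eq_sq₀ (norm_nonneg _) (Real.exp_pos _).le, norm_sq_E3]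
  simp only [shellMap]
  set S := 1 + (m * p 0) ^ 2 + (m * p 1) ^ 2 with hSdef
  set E := Real.exp (b + ε * Real.arsinh (m * p 2 / √S))
  simp
  field_simp
  have h1 : m ^ 2 * p 0 ^ 2 = S - 1 - m ^ 2 * p 1 ^ 2 := by rw [hSdef]; ring
  linear_combination 4 * h1

/-- This recovers the conformal factor from the image point as S = 2r/(r - z), the quantity under
the square root in `shellInv`. -/
theorem norm_sub_shellMap (ε b m : ℝ) (p : E3) :
    ‖shellMap ε b m p‖ - shellMap ε b m p 2 =
      2 * (‖shellMap ε b m p‖ / (1 + (m * p 0) ^ 2 + (m * p 1) ^ 2)) := by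
  have hS : 0 < 1 + (m * p 0) ^ 2 + (m * p 1) ^ 2 := by positivity
  rw [norm_shellMap]
  simp only [shellMap]
  simp
  field_simp
  ring

theorem shellMap_mem_slitSpace (ε b m : ℝ) (p : E3) : shellMap ε b m p ∈ slitSpace := by
  have hS : 0 < 1 + (m * p 0) ^ 2 + (m * p 1) ^ 2 := by positivity
  rw [slitSpace, Set.mem_ofPred_eq, norm_sub_shellMap, norm_shellMap]
  positivity

theorem shellInv_shellMap {ε b m : ℝ} (hε : ε ≠ 0) (hm : m ≠ 0) (p : E3) :
    shellInv ε b m (shellMap ε b m p) = p := by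
  have hS : 0 < 1 + (m * p 0) ^ 2 + (m * p 1) ^ 2 := by positivity
  have hn := norm_shellMap ε b m p
  have hd := norm_sub_shellMap ε b m p
  have hn0 : 0 < ‖shellMap ε b m p‖ := by rw [hn]; exact Real.exp_pos _
  rw [shellInv, hd]
  have h2 : 2 * ‖shellMap ε b m p‖ /
      (2 * (‖shellMap ε b m p‖ / (1 + (m * p 0) ^ 2 + (m * p 1) ^ 2))) =
      1 + (m * p 0) ^ 2 + (m * p 1) ^ 2 := by field_simp
  rw [h2, hn, Real.log_exp, add_sub_cancel_left, mul_div_cancel_left₀ _ hε, Real.sinh_arsinh,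
    div_mul_cancel₀ _ (Real.sqrt_pos.2 hS).ne', mul_div_cancel_left₀ _ hm]
  have hE := Real.exp_pos
    (b + ε * Real.arsinh (m * p 2 / √(1 + (m * p 0) ^ 2 + (m * p 1) ^ 2)))
  ext i
  fin_cases i
  · simp [shellMap]
    field_simp
  · simp [shellMap]
    field_simp
  · simp

theorem shellMap_shellInv {ε b m : ℝ} (hε : ε ≠ 0) (hm : m ≠ 0) {X : E3} (hX : X ∈ slitSpace) :
    shellMap ε b m (shellInv ε b m X) = X := by
  have hd : 0 < ‖X‖ - X 2 := hX
  have hn0 : 0 < ‖X‖ := norm_pos_iff.2 (ne_zero_of_mem_slitSpace hX)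
  have hsq := norm_sq_E3 X
  have h0 : m * shellInv ε b m X 0 = X 0 / (‖X‖ - X 2) := by simp [shellInv]; field_simp
  have h1 : m * shellInv ε b m X 1 = X 1 / (‖X‖ - X 2) := by simp [shellInv]; field_simp
  have h2 : m * shellInv ε b m X 2 =
      Real.sinh ((Real.log ‖X‖ - b) / ε) * √(2 * ‖X‖ / (‖X‖ - X 2)) := by
    simp [shellInv]; field_simp
  have hS : 1 + (m * shellInv ε b m X 0) ^ 2 + (m * shellInv ε b m X 1) ^ 2 =
      2 * ‖X‖ / (‖X‖ - X 2) := by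
    rw [h0, h1]; field_simp; linear_combination -hsq
  have hSpos : 0 < 2 * ‖X‖ / (‖X‖ - X 2) := by positivity
  simp only [shellMap]
  rw [hS, h0, h1, h2, mul_div_cancel_right₀ _ (Real.sqrt_pos.2 hSpos).ne', Real.arsinh_sinh,
    mul_div_cancel₀ _ hε, add_sub_cancel, Real.exp_log hn0]
  ext i
  fin_cases i
  · simp
    field_simp
  · simp
    field_simp
  · simp
    field_simp
    ring

theorem contDiff_coord (i : Fin 3) {n : WithTop ℕ∞} : ContDiff ℝ n fun p : E3 => p i :=
  contDiff_euclidean.1 contDiff_id i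

theorem contDiff_shellMap (ε b m : ℝ) : ContDiff ℝ 2 (shellMap ε b m) := by
  have hc := fun i => contDiff_coord i (n := 2)
  have hm : ∀ i, ContDiff ℝ 2 fun p : E3 => m * p i := fun i => contDiff_const.mul (hc i)
  have hS : ContDiff ℝ 2 fun p : E3 => 1 + (m * p 0) ^ 2 + (m * p 1) ^ 2 :=
    (contDiff_const.add ((hm 0).pow 2)).add ((hm 1).pow 2)
  have hS0 : ∀ p : E3, 1 + (m * p 0) ^ 2 + (m * p 1) ^ 2 ≠ 0 := fun p => by positivity
  have hT : ContDiff ℝ 2 fun p : E3 => Real.exp (b + ε * Real.arsinh (m * p 2 /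
      √(1 + (m * p 0) ^ 2 + (m * p 1) ^ 2))) / (1 + (m * p 0) ^ 2 + (m * p 1) ^ 2) :=
    (contDiff_const.add (contDiff_const.mul ((hm 2).div (hS.sqrt hS0)
      fun p => by have := hS0 p; positivity).arsinh)).exp.div hS hS0
  rw [contDiff_euclidean]
  intro i
  fin_cases i
  · exact hT.mul (contDiff_const.mul (hm 0))
  · exact hT.mul (contDiff_const.mul (hm 1))
  · exact hT.mul (hS.sub contDiff_const)

theorem contDiffOn_shellInv (ε b m : ℝ) : ContDiffOn ℝ 2 (shellInv ε b m) slitSpace := by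
  have hc := fun i => (contDiff_coord i (n := 2)).contDiffOn (s := slitSpace)
  have hn : ContDiffOn ℝ 2 (fun X : E3 => ‖X‖) slitSpace :=
    contDiffOn_id.norm ℝ fun X hX => ne_zero_of_mem_slitSpace hX
  have hn0 : ∀ X ∈ slitSpace, ‖X‖ ≠ 0 := fun X hX =>
    norm_ne_zero_iff.2 (ne_zero_of_mem_slitSpace hX)
  have hd : ContDiffOn ℝ 2 (fun X : E3 => ‖X‖ - X 2) slitSpace := hn.sub (hc 2)
  have hd0 : ∀ X ∈ slitSpace, ‖X‖ - X 2 ≠ 0 := fun X hX => ne_of_gt hX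
  rw [contDiffOn_euclidean]
  intro i
  fin_cases i
  · exact ((hc 0).div hd hd0).div_const m
  · exact ((hc 1).div hd hd0).div_const m
  · exact ((((hn.log hn0).sub contDiffOn_const).div_const ε).sinh.mul
      (((contDiffOn_const.mul hn).div hd hd0).sqrt fun X hX =>
        div_ne_zero (mul_ne_zero two_ne_zero (hn0 X hX)) (hd0 X hX))).div_const m

/-- `shellMap` as a partial homeomorphism. -/
noncomputable def shellChart (ε b m : ℝ) (hε : ε ≠ 0) (hm : m ≠ 0) :
    OpenPartialHomeomorph E3 E3 where
  toFun := shellMap ε b m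
  invFun := shellInv ε b m
  source := Set.univ
  target := slitSpace
  map_source' p _ := shellMap_mem_slitSpace ε b m p
  map_target' _ _ := Set.mem_univ _
  left_inv' p _ := shellInv_shellMap hε hm p
  right_inv' _ hX := shellMap_shellInv hε hm hX
  open_source := isOpen_univ
  open_target := isOpen_slitSpace
  continuousOn_toFun := (contDiff_shellMap ε b m).continuous.continuousOn
  continuousOn_invFun := (contDiffOn_shellInv ε b m).continuousOn

/-- The pull-back of `shellFun` by the chart is the defining function of the ball. -/
theorem shellFun_eq_norm_shellInv {ε b m : ℝ} (hm : m ≠ 0)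
    (hmε : ε ^ 2 * (1 + m ^ 2) = 4) {X : E3} (hX : X ∈ slitSpace) :
    shellFun ε b X =
      (‖shellInv ε b m X‖ ^ 2 - 1) * (ε ^ 2 * m ^ 2 * (‖X‖ - X 2) / 2) := by
  have hd : 0 < ‖X‖ - X 2 := hX
  have hn0 : 0 < ‖X‖ := norm_pos_iff.2 (ne_zero_of_mem_slitSpace hX)
  have hsq := norm_sq_E3 X
  have hxy : X 0 ^ 2 + X 1 ^ 2 = (‖X‖ - X 2) * (‖X‖ + X 2) := by linear_combination -hsq
  have hinv : ‖shellInv ε b m X‖ ^ 2 * (m ^ 2 * (‖X‖ - X 2)) =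
      ‖X‖ + X 2 + 2 * ‖X‖ * Real.sinh ((Real.log ‖X‖ - b) / ε) ^ 2 := by
    rw [norm_sq_E3]
    have e0 : shellInv ε b m X 0 = X 0 / (‖X‖ - X 2) / m := rfl
    have e1 : shellInv ε b m X 1 = X 1 / (‖X‖ - X 2) / m := rfl
    have e2 : shellInv ε b m X 2 =
      Real.sinh ((Real.log ‖X‖ - b) / ε) * √(2 * ‖X‖ / (‖X‖ - X 2)) / m := rfl
    rw [e0, e1, e2, div_pow _ m, div_pow _ m, div_pow _ m, mul_pow, Real.sq_sqrt (by positivity)]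
    field_simp
    linear_combination hxy
  rw [shellFun, Real.cosh_sq]
  linear_combination (‖X‖ - X 2) / 2 * hmε - ε ^ 2 / 2 * hinv

/-- On the upper half-axis z = r, where the function is r ε² cosh² > 0: the hole contains the whole
half-axis, so the chart misses no point of the shell. -/
theorem mem_slitSpace_of_shellFun_nonpos {ε b : ℝ} (hε : 0 < ε) {X : E3} (hX : X ≠ 0)
    (h : shellFun ε b X ≤ 0) : X ∈ slitSpace := by
  have hn : 0 < ‖X‖ := norm_pos_iff.2 hX
  have hc := Real.cosh_pos ((Real.log ‖X‖ - b) / ε)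
  have hpos : 0 < ‖X‖ * (ε ^ 2 * Real.cosh ((Real.log ‖X‖ - b) / ε) ^ 2) := by positivity
  rw [shellFun] at h
  change 0 < ‖X‖ - X 2
  linarith

/-- A value of the scale for which `shellMap` takes the unit ball to the shell. -/
theorem exists_shell_scale {ε : ℝ} (hε : 0 < ε) (hε1 : ε ≤ 1) :
    ∃ m : ℝ, m ≠ 0 ∧ ε ^ 2 * (1 + m ^ 2) = 4 := by
  have h : 1 ≤ 1 / ε ^ 2 := by rw [le_div_iff₀ (by positivity)]; nlinarith
  have hpos : 0 < 4 / ε ^ 2 - 1 := by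
    have : 4 / ε ^ 2 = 4 * (1 / ε ^ 2) := by ring
    linarith
  refine ⟨√(4 / ε ^ 2 - 1), (Real.sqrt_pos.2 hpos).ne', ?_⟩
  rw [Real.sq_sqrt hpos.le]
  field_simp
  ring

section

variable {ε b m : ℝ}

theorem shellFun_shellMap_sign (hε : 0 < ε) (hm : m ≠ 0) (hmε : ε ^ 2 * (1 + m ^ 2) = 4)
    (p : E3) : (shellFun ε b (shellMap ε b m p) < 0 ↔ ‖p‖ < 1) ∧
      (shellFun ε b (shellMap ε b m p) = 0 ↔ ‖p‖ = 1) := by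
  have hX := shellMap_mem_slitSpace ε b m p
  have hd : 0 < ‖shellMap ε b m p‖ - shellMap ε b m p 2 := hX
  have hpos : 0 < ε ^ 2 * m ^ 2 * (‖shellMap ε b m p‖ - shellMap ε b m p 2) / 2 := by positivity
  rw [shellFun_eq_norm_shellInv hm hmε hX, shellInv_shellMap hε.ne' hm]
  constructor
  · rw [← sq_lt_one_iff₀ (norm_nonneg p), ← sub_neg (a := ‖p‖ ^ 2)]
    refine ⟨fun h => ?_, fun h => mul_neg_of_neg_of_pos h hpos⟩
    by_contra! hcon
    exact absurd h (mul_nonneg hcon hpos.le).not_gt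
  · rw [mul_eq_zero, or_iff_left hpos.ne', sub_eq_zero,
      pow_eq_one_iff_of_nonneg (norm_nonneg p) two_ne_zero]

theorem image_ball_eq_shell (hε : 0 < ε) (hm : m ≠ 0) (hmε : ε ^ 2 * (1 + m ^ 2) = 4) :
    shellMap ε b m '' ball 0 1 = shell ε b := by
  ext X
  constructor
  · rintro ⟨p, hp, rfl⟩
    exact ⟨ne_zero_of_mem_slitSpace (shellMap_mem_slitSpace ε b m p),
      (shellFun_shellMap_sign hε hm hmε p).1.2 (mem_ball_zero_iff.1 hp)⟩
  · rintro ⟨hX0, hX⟩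
    have hslit := mem_slitSpace_of_shellFun_nonpos hε hX0 hX.le
    have hr := shellMap_shellInv (b := b) hε.ne' hm hslit
    refine ⟨_, ?_, hr⟩
    rw [← hr, (shellFun_shellMap_sign hε hm hmε _).1] at hX
    exact mem_ball_zero_iff.2 hX

theorem isOpen_shell (hε : 0 < ε) (hε1 : ε ≤ 1) : IsOpen (shell ε b) := by
  obtain ⟨m, hm, hmε⟩ := exists_shell_scale hε hε1
  rw [← image_ball_eq_shell hε hm hmε]
  exact (shellChart ε b m hε.ne' hm).isOpen_image_of_subset_source isOpen_ball
    (Set.subset_univ _)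

/-- The image of the closed ball is compact, hence is the closure of the shell; injectivity then
removes the image of the open ball. -/
theorem frontier_shell_eq (hε : 0 < ε) (hε1 : ε ≤ 1) (hm : m ≠ 0)
    (hmε : ε ^ 2 * (1 + m ^ 2) = 4) : frontier (shell ε b) = shellMap ε b m '' sphere 0 1 := by
  have hcont : Continuous (shellMap ε b m) := (contDiff_shellMap ε b m).continuous
  have hinj : Function.Injective (shellMap ε b m) :=
    Function.LeftInverse.injective (shellInv_shellMap hε.ne' hm)
  have hcl : closure (shell ε b) = shellMap ε b m '' closedBall 0 1 := by
    rw [← image_ball_eq_shell hε hm hmε, ← closure_ball (0 : E3) one_ne_zero]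
    refine subset_antisymm (closure_minimal (Set.image_mono subset_closure) ?_)
      (image_closure_subset_closure_image hcont)
    rw [closure_ball (0 : E3) one_ne_zero]
    exact ((isCompact_closedBall 0 1).image hcont).isClosed
  rw [(isOpen_shell hε hε1).frontier_eq, hcl, ← image_ball_eq_shell hε hm hmε,
    ← Set.image_sdiff hinj, closedBall_sdiff_ball]

theorem frontier_shell_subset (hε : 0 < ε) (hε1 : ε ≤ 1) :
    frontier (shell ε b) ⊆ {X | X ≠ 0 ∧ shellFun ε b X = 0} := by
  obtain ⟨m, hm, hmε⟩ := exists_shell_scale hε hε1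
  rw [frontier_shell_eq hε hε1 hm hmε]
  rintro _ ⟨p, hp, rfl⟩
  exact ⟨ne_zero_of_mem_slitSpace (shellMap_mem_slitSpace ε b m p),
    (shellFun_shellMap_sign hε hm hmε p).2.2 (mem_sphere_zero_iff_norm.1 hp)⟩

theorem contDiffOn_shellFun : ContDiffOn ℝ 2 (shellFun ε b) {0}ᶜ := by
  have hn : ContDiffOn ℝ 2 (fun X : E3 => ‖X‖) {0}ᶜ := contDiffOn_id.norm ℝ fun X hX => hX
  have hlog := hn.log fun X hX => norm_ne_zero_iff.2 hX
  exact (hn.mul ((contDiffOn_const.mul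
    (((hlog.sub contDiffOn_const).div_const ε).cosh.pow 2)).sub contDiffOn_const)).add
    (contDiffOn_const.mul (contDiff_coord 2).contDiffOn)

theorem isC11Domain_shell (hε : 0 < ε) (hε1 : ε ≤ 1) : IsC11Domain (shell ε b) := by
  refine ⟨isOpen_shell hε hε1, fun X hX => ?_⟩
  obtain ⟨hX0, h0⟩ := frontier_shell_subset hε hε1 hX
  have hopen : IsOpen ({0}ᶜ : Set E3) := isOpen_compl_singleton
  have hcont : ContinuousAt (fderiv ℝ (shellFun ε b)) X :=
    ((contDiffOn_shellFun.contDiffAt (hopen.mem_nhds hX0)).fderiv_right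
      (m := 1) (by norm_num)).continuousAt
  have hne : fderiv ℝ (shellFun ε b) X ≠ 0 := by
    rw [(hasFDerivAt_shellFun hX0).fderiv]
    intro h
    have := shellGrad_ne_zero hε hε1 hX0 h0
    rw [← norm_ne_zero_iff, ← innerSL_apply_norm ℝ, h, norm_zero] at this
    exact this rfl
  obtain ⟨r, hr, hball⟩ := Metric.eventually_nhds_iff_ball.1
    ((hcont.eventually_ne hne).and (hopen.mem_nhds hX0))
  refine ⟨r, hr, shellFun ε b, ContDiffOn.c11On isOpen_ball
    (contDiffOn_shellFun.mono fun y hy => (hball y hy).2), fun y hy => (hball y hy).1,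
    fun y hy => ⟨fun h => h.2, fun h => ⟨(hball y hy).2, h⟩⟩⟩

theorem isC11BallDomain_shell (hε : 0 < ε) (hε1 : ε ≤ 1) : IsC11BallDomain (shell ε b) := by
  obtain ⟨m, hm, hmε⟩ := exists_shell_scale hε hε1
  exact ⟨isC11Domain_shell hε hε1, shellChart ε b m hε.ne' hm, Set.subset_univ _,
    (contDiff_shellMap ε b m).contDiffOn.c11On isOpen_univ,
    (contDiffOn_shellInv ε b m).c11On isOpen_slitSpace, image_ball_eq_shell hε hm hmε⟩

theorem isConnected_shell (hε : 0 < ε) (hε1 : ε ≤ 1) : IsConnected (shell ε b) := by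
  obtain ⟨m, hm, hmε⟩ := exists_shell_scale hε hε1
  rw [← image_ball_eq_shell hε hm hmε]
  exact ((convex_ball (0 : E3) 1).isConnected ⟨0, mem_ball_self one_pos⟩).image _
    (contDiff_shellMap ε b m).continuous.continuousOn

theorem isConnected_frontier_shell (hε : 0 < ε) (hε1 : ε ≤ 1) :
    IsConnected (frontier (shell ε b)) := by
  obtain ⟨m, hm, hmε⟩ := exists_shell_scale hε hε1
  rw [frontier_shell_eq hε hε1 hm hmε]
  refine (isConnected_sphere ?_ (0 : E3) zero_le_one).image _
    (contDiff_shellMap ε b m).continuous.continuousOn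
  rw [← Module.finrank_eq_rank, finrank_euclideanSpace_fin]
  norm_num

theorem isBounded_shell (hε : 0 < ε) (hε1 : ε ≤ 1) : Bornology.IsBounded (shell ε b) := by
  obtain ⟨m, hm, hmε⟩ := exists_shell_scale hε hε1
  rw [← image_ball_eq_shell hε hm hmε]
  exact ((isCompact_closedBall (0 : E3) 1).image
    (contDiff_shellMap ε b m).continuous).isBounded.subset (Set.image_mono ball_subset_closedBall)

end

/-! ### Scaling, thickness and volume -/

theorem shellFun_smul {ε b : ℝ} {X : E3} (hX : X ≠ 0) :
    shellFun ε 0 ((Real.exp b)⁻¹ • X) = (Real.exp b)⁻¹ * shellFun ε b X := by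
  have hn : ‖X‖ ≠ 0 := norm_ne_zero_iff.2 hX
  have he : (Real.exp b)⁻¹ ≠ 0 := by positivity
  have hnorm : ‖(Real.exp b)⁻¹ • X‖ = (Real.exp b)⁻¹ * ‖X‖ := by
    rw [norm_smul, Real.norm_of_nonneg (by positivity)]
  have hz : ((Real.exp b)⁻¹ • X) 2 = (Real.exp b)⁻¹ * X 2 := rfl
  rw [shellFun, shellFun, hnorm, hz, Real.log_mul he hn, Real.log_inv, Real.log_exp,
    show (-b + Real.log ‖X‖ - 0) = Real.log ‖X‖ - b by ring]
  ring

open scoped Pointwise in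
theorem shell_eq_smul (ε b : ℝ) : shell ε b = Real.exp b • shell ε 0 := by
  ext X
  rw [Set.mem_smul_set_iff_inv_smul_mem₀ (Real.exp_pos b).ne']
  have he : 0 < (Real.exp b)⁻¹ := by positivity
  have h1 : (Real.exp b)⁻¹ • X ≠ 0 ↔ X ≠ 0 := by
    rw [Ne, smul_eq_zero, or_iff_right he.ne']
  refine ⟨fun h => ⟨h1.2 h.1, ?_⟩, fun h => ⟨h1.1 h.1, ?_⟩⟩
  · rw [shellFun_smul h.1]
    exact mul_neg_of_pos_of_neg he h.2
  · have h2 := h.2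
    rw [shellFun_smul (h1.1 h.1)] at h2
    by_contra! hcon
    exact absurd h2 (mul_nonneg he.le hcon).not_gt

theorem volume_shell (ε b : ℝ) :
    volume (shell ε b) = ENNReal.ofReal (Real.exp b ^ 3) * volume (shell ε 0) := by
  rw [shell_eq_smul, Measure.addHaar_smul, finrank_euclideanSpace_fin,
    abs_of_pos (by positivity : 0 < Real.exp b ^ 3)]

/-- From ε cosh τ ≤ 2 and exp|τ| ≤ 2 cosh τ one gets exp|τ| ≤ 4/ε. -/
theorem abs_log_norm_sub_le {ε b : ℝ} (hε : 0 < ε) {X : E3} (hX : X ≠ 0)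
    (h : shellFun ε b X ≤ 0) : |Real.log ‖X‖ - b| ≤ ε * Real.log (4 / ε) := by
  have hA := shellFun_bound hX h
  set τ := (Real.log ‖X‖ - b) / ε with hτ
  have hc := Real.cosh_pos τ
  have h1 : ε * Real.cosh τ ≤ 2 := by
    refine le_of_sq_le_sq ?_ zero_le_two
    rw [mul_pow]; linarith
  have h2 : Real.exp |τ| ≤ 4 / ε := by
    rw [le_div_iff₀ hε]
    have h3 := Real.cosh_eq |τ|
    have h4 := Real.exp_pos (-|τ|)
    rw [Real.cosh_abs] at h3
    nlinarith
  have h5 : |τ| ≤ Real.log (4 / ε) := (Real.le_log_iff_exp_le (by positivity)).2 h2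
  have h6 : Real.log ‖X‖ - b = ε * τ := by rw [hτ]; field_simp
  rw [h6, abs_mul, abs_of_pos hε]
  gcongr

/-- A bound on log r - b uniform in ε, coarse but sufficient for the curvature and area constants;
it uses log x ≤ x. -/
theorem abs_log_norm_sub_le_four {ε b : ℝ} (hε : 0 < ε) {X : E3} (hX : X ≠ 0)
    (h : shellFun ε b X ≤ 0) : |Real.log ‖X‖ - b| ≤ 4 := by
  refine (abs_log_norm_sub_le hε hX h).trans ?_
  have h1 := Real.log_le_sub_one_of_pos (by positivity : 0 < 4 / ε)
  calc ε * Real.log (4 / ε) ≤ ε * (4 / ε) := by gcongr; linarith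
    _ = 4 := by field_simp

theorem tendsto_shell_thickness :
    Tendsto (fun ε : ℝ => ε * Real.log (4 / ε)) (𝓝[>] 0) (𝓝 0) := by
  have h : Tendsto (fun ε : ℝ => ε * Real.log 4 - ε * Real.log ε) (𝓝 0)
      (𝓝 (0 * Real.log 4 - 0 * Real.log 0)) :=
    ((continuous_id.mul continuous_const).sub Real.continuous_mul_log).tendsto 0
  rw [zero_mul, zero_mul, sub_zero] at h
  refine (h.mono_left nhdsWithin_le_nhds).congr' ?_
  filter_upwards [self_mem_nhdsWithin] with ε hε
  have hε : 0 < ε := hε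
  rw [Real.log_div (by norm_num) hε.ne']
  ring

theorem volume_shell_le {ε : ℝ} (hε : 0 < ε) :
    volume (shell ε 0) ≤ ENNReal.ofReal (Real.exp (ε * Real.log (4 / ε)) ^ 3 -
      Real.exp (-(ε * Real.log (4 / ε))) ^ 3) * volume (ball (0 : E3) 1) := by
  set δ := ε * Real.log (4 / ε)
  have hsub : shell ε 0 ⊆ closedBall 0 (Real.exp δ) \ ball 0 (Real.exp (-δ)) := by
    rintro X ⟨hX, h⟩
    have hn : 0 < ‖X‖ := norm_pos_iff.2 hX
    have hb := abs_le.1 (abs_log_norm_sub_le hε hX h.le)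
    rw [sub_zero] at hb
    rw [Set.mem_sdiff, mem_closedBall_zero_iff, mem_ball_zero_iff, not_lt]
    exact ⟨(Real.log_le_iff_le_exp hn).1 hb.2, (Real.le_log_iff_exp_le hn).1 hb.1⟩
  -- For ε > 4 the thickness bound δ is negative; the shell is then empty.
  rcases le_or_gt 0 δ with hδ | hδ
  · refine (measure_mono hsub).trans ?_
    rw [measure_sdiff (ball_subset_closedBall.trans (closedBall_subset_closedBall
      (Real.exp_le_exp.2 (by linarith)))) measurableSet_ball.nullMeasurableSet
      measure_ball_lt_top.ne, Measure.addHaar_closedBall _ _ (Real.exp_pos _).le,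
      Measure.addHaar_ball _ _ (Real.exp_pos _).le, finrank_euclideanSpace_fin,
      ENNReal.ofReal_sub _ (by positivity), ENNReal.sub_mul fun _ _ => measure_ball_lt_top.ne]
  · have : shell ε 0 = ∅ := by
      refine Set.eq_empty_of_forall_notMem fun X hX => ?_
      have h := hsub hX
      rw [Set.mem_sdiff, mem_closedBall_zero_iff, mem_ball_zero_iff, not_lt] at h
      have := Real.exp_le_exp.1 (h.2.trans h.1)
      linarith
    rw [this, measure_empty]
    exact zero_le

theorem tendsto_volume_shell :
    Tendsto (fun ε : ℝ => volume (shell ε 0)) (𝓝[>] 0) (𝓝 0) := by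
  have h1 : Tendsto (fun δ : ℝ => ENNReal.ofReal (Real.exp δ ^ 3 - Real.exp (-δ) ^ 3) *
      volume (ball (0 : E3) 1)) (𝓝 0) (𝓝 (ENNReal.ofReal (Real.exp 0 ^ 3 - Real.exp (-0) ^ 3) *
      volume (ball (0 : E3) 1))) := by
    refine ENNReal.Tendsto.mul_const (ENNReal.tendsto_ofReal ?_) (Or.inr measure_ball_lt_top.ne)
    apply Continuous.tendsto
    fun_prop
  rw [neg_zero, sub_self, ENNReal.ofReal_zero, zero_mul] at h1
  refine tendsto_of_tendsto_of_tendsto_of_le_of_le' tendsto_const_nhds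
    (h1.comp tendsto_shell_thickness) (Eventually.of_forall fun _ => zero_le) ?_
  filter_upwards [self_mem_nhdsWithin] with ε hε using volume_shell_le hε

/-- There are shells of unit volume and arbitrarily large radius. -/
theorem exists_shell_volume_eq_one (Λ : ℝ) :
    ∃ ε b : ℝ, 0 < ε ∧ ε ≤ 1 ∧ volume (shell ε b) = 1 ∧ Λ ≤ Real.exp b := by
  set M := max Λ 1
  have hM : 0 < M := lt_max_of_lt_right one_pos
  have hpos : 0 < ENNReal.ofReal (M ^ 3)⁻¹ := ENNReal.ofReal_pos.2 (by positivity)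
  obtain ⟨ε, hV, hε⟩ := ((tendsto_volume_shell.eventually (gt_mem_nhds hpos)).and
    (Ioo_mem_nhdsGT one_pos)).exists
  have hV0 : volume (shell ε 0) ≠ 0 :=
    ((isOpen_shell hε.1 hε.2.le).measure_pos _ (isConnected_shell hε.1 hε.2.le).nonempty).ne'
  have hVtop : volume (shell ε 0) ≠ ⊤ := ne_top_of_lt hV
  set v := (volume (shell ε 0)).toReal with hv
  have hv0 : 0 < v := ENNReal.toReal_pos hV0 hVtop
  have hveq : volume (shell ε 0) = ENNReal.ofReal v := (ENNReal.ofReal_toReal hVtop).symm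
  have hvM : v < (M ^ 3)⁻¹ := by
    rw [hveq] at hV
    exact (ENNReal.ofReal_lt_ofReal_iff (by positivity)).1 hV
  have hexp : Real.exp (-(Real.log v) / 3) ^ 3 = v⁻¹ := by
    rw [← Real.exp_nat_mul, ← Real.exp_log (inv_pos.2 hv0), Real.log_inv]
    congr 1
    push_cast
    ring
  -- This b gives e^(3b) = 1/v, which normalises the volume; v < M⁻³ then forces e^b ≥ M ≥ Λ.
  refine ⟨ε, -(Real.log v) / 3, hε.1, hε.2.le, ?_, (le_max_left Λ 1).trans ?_⟩
  · rw [volume_shell, hexp, hveq, ← ENNReal.ofReal_mul (by positivity),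
      inv_mul_cancel₀ hv0.ne', ENNReal.ofReal_one]
  · refine le_of_pow_le_pow_left₀ three_ne_zero (Real.exp_pos _).le ?_
    rw [hexp]
    exact ((lt_inv_comm₀ hv0 (by positivity)).1 hvM).le

/-! ### Area of the boundary, uniformly in ε -/

/-- Spherical coordinates. -/
noncomputable def sphPoint (r θ φ : ℝ) : E3 :=
  !₂[r * (Real.sin θ * Real.cos φ), r * (Real.sin θ * Real.sin φ), r * Real.cos θ]

theorem exists_eq_sphPoint {X : E3} (hX : X ≠ 0) :
    ∃ θ ∈ Set.Icc 0 Real.pi, ∃ φ ∈ Set.Icc (-4 : ℝ) 4, X = sphPoint ‖X‖ θ φ := by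
  have hn : 0 < ‖X‖ := norm_pos_iff.2 hX
  have hsq := norm_sq_E3 X
  have hz : |X 2| ≤ ‖X‖ := by
    have := abs_real_inner_le_norm axis X
    rwa [inner_axis, norm_axis, one_mul] at this
  have hcos : Real.cos (Real.arccos (X 2 / ‖X‖)) = X 2 / ‖X‖ := by
    rw [abs_le] at hz
    refine Real.cos_arccos ?_ ?_
    · rw [le_div_iff₀ hn]; linarith
    · rw [div_le_one hn]; exact hz.2
  set w : ℂ := ⟨X 0, X 1⟩ with hw
  have hsin : ‖X‖ * Real.sin (Real.arccos (X 2 / ‖X‖)) = ‖w‖ := by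
    have hs := Real.sin_nonneg_of_nonneg_of_le_pi (Real.arccos_nonneg (X 2 / ‖X‖))
      (Real.arccos_le_pi _)
    rw [← sq_eq_sq₀ (by positivity) (norm_nonneg _), mul_pow, Real.sin_sq, hcos,
      ← Complex.normSq_eq_norm_sq, Complex.normSq_apply, hw]
    field_simp
    linear_combination hsq
  have hpi := Real.pi_le_four
  refine ⟨_, ⟨Real.arccos_nonneg (X 2 / ‖X‖), Real.arccos_le_pi _⟩, w.arg,
    ⟨by linarith [Complex.neg_pi_lt_arg w], by linarith [Complex.arg_le_pi w]⟩, ?_⟩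
  ext i
  fin_cases i
  · have := Complex.norm_mul_cos_arg w
    simp only [sphPoint]
    simp
    rw [← mul_assoc, hsin, this]
  · have := Complex.norm_mul_sin_arg w
    simp only [sphPoint]
    simp
    rw [← mul_assoc, hsin, this]
  · simp only [sphPoint]
    simp
    rw [hcos]
    field_simp

/-- Changing one coordinate at a time, each angular step is a chord, bounded by its arc through 1 -
x²/2 ≤ cos x. -/
theorem norm_sphPoint_sub_le {r r' R θ θ' φ φ' : ℝ} (hr' : 0 ≤ r') (hR' : r' ≤ R) :
    ‖sphPoint r θ φ - sphPoint r' θ' φ'‖ ≤ |r - r'| + R * |θ - θ'| + R * |φ - φ'| := by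
  have h1 : ‖sphPoint r θ φ - sphPoint r' θ φ‖ ≤ |r - r'| := by
    refine le_of_sq_le_sq ?_ (abs_nonneg _)
    rw [norm_sq_E3, sq_abs]
    simp [sphPoint]
    have e1 := Real.sin_sq_add_cos_sq θ
    have e2 := Real.sin_sq_add_cos_sq φ
    refine le_of_eq ?_
    linear_combination (r - r') ^ 2 * e1 + (r - r') ^ 2 * Real.sin θ ^ 2 * e2
  have h2 : ‖sphPoint r' θ φ - sphPoint r' θ' φ‖ ≤ R * |θ - θ'| := by
    refine le_trans ?_ (mul_le_mul_of_nonneg_right hR' (abs_nonneg _))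
    refine le_of_sq_le_sq ?_ (by positivity)
    rw [norm_sq_E3, mul_pow, sq_abs]
    simp [sphPoint]
    have e1 := Real.sin_sq_add_cos_sq θ
    have e1' := Real.sin_sq_add_cos_sq θ'
    have e2 := Real.sin_sq_add_cos_sq φ
    have e3 := Real.one_sub_sq_div_two_le_cos (x := θ - θ')
    rw [Real.cos_sub] at e3
    have e4 := mul_le_mul_of_nonneg_left e3 (sq_nonneg r')
    have : (r' * (Real.sin θ * Real.cos φ) - r' * (Real.sin θ' * Real.cos φ)) ^ 2 +
        (r' * (Real.sin θ * Real.sin φ) - r' * (Real.sin θ' * Real.sin φ)) ^ 2 +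
        (r' * Real.cos θ - r' * Real.cos θ') ^ 2 =
        2 * r' ^ 2 * (1 - (Real.cos θ * Real.cos θ' + Real.sin θ * Real.sin θ')) := by
      linear_combination r' ^ 2 * (Real.sin θ - Real.sin θ') ^ 2 * e2 + r' ^ 2 * e1 + r' ^ 2 * e1'
    rw [this]
    linarith
  have h3 : ‖sphPoint r' θ' φ - sphPoint r' θ' φ'‖ ≤ R * |φ - φ'| := by
    refine le_trans ?_ (mul_le_mul_of_nonneg_right hR' (abs_nonneg _))
    refine le_of_sq_le_sq ?_ (by positivity)
    rw [norm_sq_E3, mul_pow, sq_abs]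
    simp [sphPoint]
    have e2 := Real.sin_sq_add_cos_sq φ
    have e2' := Real.sin_sq_add_cos_sq φ'
    have e3 := Real.one_sub_sq_div_two_le_cos (x := φ - φ')
    rw [Real.cos_sub] at e3
    have e5 : r' ^ 2 * Real.sin θ' ^ 2 ≤ r' ^ 2 :=
      mul_le_of_le_one_right (sq_nonneg _) (Real.sin_sq_le_one θ')
    have e4 := mul_le_mul_of_nonneg_left e3
      (by positivity : 0 ≤ r' ^ 2 * Real.sin θ' ^ 2)
    have e6 := mul_le_mul_of_nonneg_right e5 (sq_nonneg (φ - φ'))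
    have : (r' * (Real.sin θ' * Real.cos φ) - r' * (Real.sin θ' * Real.cos φ')) ^ 2 +
        (r' * (Real.sin θ' * Real.sin φ) - r' * (Real.sin θ' * Real.sin φ')) ^ 2 =
        2 * (r' ^ 2 * Real.sin θ' ^ 2) *
          (1 - (Real.cos φ * Real.cos φ' + Real.sin φ * Real.sin φ')) := by
      linear_combination r' ^ 2 * Real.sin θ' ^ 2 * e2 + r' ^ 2 * Real.sin θ' ^ 2 * e2'
    rw [this]
    linarith
  calc _ = ‖(sphPoint r θ φ - sphPoint r' θ φ) + (sphPoint r' θ φ - sphPoint r' θ' φ) +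
        (sphPoint r' θ' φ - sphPoint r' θ' φ')‖ := by congr 1; abel
    _ ≤ _ := (norm_add₃_le).trans (by gcongr)

theorem abs_exp_sub_exp_le {x y M : ℝ} (hx : x ≤ M) (hy : y ≤ M) :
    |Real.exp x - Real.exp y| ≤ Real.exp M * |x - y| := by
  wlog h : y ≤ x generalizing x y
  · rw [abs_sub_comm, abs_sub_comm x]
    exact this hy hx (le_of_not_ge h)
  rw [abs_of_nonneg (sub_nonneg.2 (Real.exp_le_exp.2 h)), abs_of_nonneg (sub_nonneg.2 h)]
  have h1 := Real.add_one_le_exp (y - x)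
  have h2 : Real.exp y = Real.exp x * Real.exp (y - x) := by rw [← Real.exp_add]; congr 1; ring
  have h3 := Real.exp_le_exp.2 hx
  have h4 := Real.exp_pos x
  calc Real.exp x - Real.exp y = Real.exp x * (1 - Real.exp (y - x)) := by rw [h2]; ring
    _ ≤ Real.exp x * (x - y) := mul_le_mul_of_nonneg_left (by linarith) h4.le
    _ ≤ Real.exp M * (x - y) := mul_le_mul_of_nonneg_right h3 (sub_nonneg.2 h)

/-- The profile curve of the boundary of the shell: the distance to the middle sphere, in
logarithmic scale, against the polar angle. -/
def profileCurve (ε : ℝ) : Set (ℝ × ℝ) :=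
  {q | q.1 ∈ Set.Icc 0 4 ∧ q.2 ∈ Set.Icc 0 Real.pi ∧
    ε ^ 2 * Real.cosh (q.1 / ε) ^ 2 = 2 - 2 * Real.cos q.2}

/-- Along the curve both coordinates increase together, since cosh and -cos are increasing on the
ranges used. The sum of the coordinates is thus a parameter with Lipschitz inverse whose constant
does not depend on ε, although the slope of the curve does. -/
theorem profileCurve_monotone {ε : ℝ} (hε : 0 < ε) {q q' : ℝ × ℝ} (hq : q ∈ profileCurve ε)
    (hq' : q' ∈ profileCurve ε) :
    |q.1 - q'.1| + |q.2 - q'.2| ≤ |(q.1 + q.2) - (q'.1 + q'.2)| := by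
  wlog h : q.1 ≤ q'.1 generalizing q q'
  · rw [abs_sub_comm, abs_sub_comm q.2, abs_sub_comm (q.1 + q.2)]
    exact this hq' hq (le_of_not_ge h)
  have hcosh : Real.cosh (q.1 / ε) ≤ Real.cosh (q'.1 / ε) := by
    rw [Real.cosh_le_cosh, abs_of_nonneg (div_nonneg hq.1.1 hε.le),
      abs_of_nonneg (div_nonneg hq'.1.1 hε.le)]
    gcongr
  have hsq : ε ^ 2 * Real.cosh (q.1 / ε) ^ 2 ≤ ε ^ 2 * Real.cosh (q'.1 / ε) ^ 2 := by
    have := Real.cosh_pos (q.1 / ε)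
    gcongr
  rw [hq.2.2, hq'.2.2] at hsq
  have h2 : q.2 ≤ q'.2 :=
    (Real.strictAntiOn_cos.le_iff_ge hq'.2.1 hq.2.1).1 (by linarith)
  rw [abs_of_nonpos (by linarith), abs_of_nonpos (by linarith), abs_of_nonpos (by linarith)]
  linarith

open Classical in
/-- The parametrisation of one half of the boundary of the shell by the sum of the coordinates on
the profile curve and the longitude. -/
noncomputable def halfShellParam (ε b σ : ℝ) (p : ℝ × ℝ) : E3 :=
  if h : ∃ q ∈ profileCurve ε, q.1 + q.2 = p.1 then
    sphPoint (Real.exp (b + σ * h.choose.1)) h.choose.2 p.2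
  else 0

theorem halfShellParam_eq {ε b σ : ℝ} (hε : 0 < ε) {q : ℝ × ℝ} (hq : q ∈ profileCurve ε) (φ : ℝ) :
    halfShellParam ε b σ (q.1 + q.2, φ) = sphPoint (Real.exp (b + σ * q.1)) q.2 φ := by
  have h : ∃ q' ∈ profileCurve ε, q'.1 + q'.2 = (q.1 + q.2, φ).1 := ⟨q, hq, rfl⟩
  rw [halfShellParam, dif_pos h]
  obtain ⟨hc, hs⟩ := h.choose_spec
  have hm := profileCurve_monotone hε hc hq
  simp only at hs
  rw [hs, sub_self, abs_zero] at hm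
  have h1 : h.choose.1 = q.1 := sub_eq_zero.1 (abs_eq_zero.1
    (le_antisymm (by linarith [abs_nonneg (h.choose.2 - q.2)]) (abs_nonneg _)))
  have h2 : h.choose.2 = q.2 := sub_eq_zero.1 (abs_eq_zero.1
    (le_antisymm (by linarith [abs_nonneg (h.choose.1 - q.1)]) (abs_nonneg _)))
  rw [h1, h2]

/-- The domain of `halfShellParam`. -/
def halfShellDomain (ε : ℝ) : Set (ℝ × ℝ) :=
  {p | (∃ q ∈ profileCurve ε, q.1 + q.2 = p.1) ∧ p.2 ∈ Set.Icc (-4 : ℝ) 4}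

theorem lipschitzOnWith_halfShellParam {ε b σ : ℝ} (hε : 0 < ε) (hσ : |σ| = 1) :
    LipschitzOnWith (Real.toNNReal (2 * Real.exp (b + 4))) (halfShellParam ε b σ)
      (halfShellDomain ε) := by
  refine LipschitzOnWith.of_dist_le_mul ?_
  rintro ⟨s, φ⟩ ⟨⟨q, hq, hqs⟩, hφ⟩ ⟨s', φ'⟩ ⟨⟨q', hq', hqs'⟩, hφ'⟩
  simp only at hqs hqs'
  subst hqs hqs'
  rw [halfShellParam_eq hε hq, halfShellParam_eq hε hq', dist_eq_norm,
    Real.coe_toNNReal _ (by positivity)]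
  have hle : ∀ q ∈ profileCurve ε, b + σ * q.1 ≤ b + 4 := by
    intro q hq
    have : σ * q.1 ≤ |σ * q.1| := le_abs_self _
    rw [abs_mul, hσ, one_mul, abs_of_nonneg hq.1.1] at this
    linarith [hq.1.2]
  have h1 := abs_exp_sub_exp_le (hle q hq) (hle q' hq')
  rw [add_sub_add_left_eq_sub, ← mul_sub, abs_mul, hσ, one_mul] at h1
  have h2 := norm_sphPoint_sub_le (r := Real.exp (b + σ * q.1)) (θ := q.2) (θ' := q'.2) (φ := φ)
    (φ' := φ') (Real.exp_pos (b + σ * q'.1)).le (Real.exp_le_exp.2 (hle q' hq'))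
  have h3 := profileCurve_monotone hε hq hq'
  have h4 : |(q.1 + q.2) - (q'.1 + q'.2)| ≤ dist (q.1 + q.2, φ) (q'.1 + q'.2, φ') := by
    rw [← Real.dist_eq]; exact le_max_left _ _
  have h5 : |φ - φ'| ≤ dist (q.1 + q.2, φ) (q'.1 + q'.2, φ') := by
    rw [← Real.dist_eq]; exact le_max_right _ _
  calc _ ≤ Real.exp (b + 4) * ((|q.1 - q'.1| + |q.2 - q'.2|) + |φ - φ'|) := by linarith
    _ ≤ Real.exp (b + 4) * (dist (q.1 + q.2, φ) (q'.1 + q'.2, φ') +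
        dist (q.1 + q.2, φ) (q'.1 + q'.2, φ')) := by
      gcongr; exact h3.trans h4
    _ = _ := by ring

/-- The parameter |t| + θ lies in [0, 4 + π] ⊆ [0, 8] and the longitude in [-4, 4], so the domain
sits in a rectangle of area 64. -/
theorem hausdorffMeasure_halfShellDomain_le (ε : ℝ) :
    Measure.hausdorffMeasure 2 (halfShellDomain ε) ≤ 64 := by
  have hsub : halfShellDomain ε ⊆ Set.Icc (0 : ℝ) 8 ×ˢ Set.Icc (-4 : ℝ) 4 := by
    rintro ⟨s, φ⟩ ⟨⟨q, hq, rfl⟩, hφ⟩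
    have hpi := Real.pi_le_four
    exact ⟨⟨by linarith [hq.1.1, hq.2.1.1], by linarith [hq.1.2, hq.2.1.2]⟩, hφ⟩
  refine (measure_mono hsub).trans ?_
  rw [hausdorffMeasure_prod_real, Measure.volume_eq_prod, Measure.prod_prod, Real.volume_Icc,
    Real.volume_Icc, ← ENNReal.ofReal_mul (by norm_num)]
  norm_num

/-- The boundary equation is even in t, so both sheets have the same profile in |t|; the sign σ
selects the outer or inner one. -/
theorem frontier_shell_subset_param {ε b : ℝ} (hε : 0 < ε) (hε1 : ε ≤ 1) :
    frontier (shell ε b) ⊆ halfShellParam ε b 1 '' halfShellDomain ε ∪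
      halfShellParam ε b (-1) '' halfShellDomain ε := by
  intro X hX
  obtain ⟨hX0, h0⟩ := frontier_shell_subset hε hε1 hX
  have hn : 0 < ‖X‖ := norm_pos_iff.2 hX0
  have ht := abs_log_norm_sub_le_four hε hX0 h0.le
  obtain ⟨θ, hθ, φ, hφ, hXe⟩ := exists_eq_sphPoint hX0
  have hz : X 2 = ‖X‖ * Real.cos θ := congrArg (fun Y : E3 => Y 2) hXe
  set t := Real.log ‖X‖ - b with htdef
  have hexp : Real.exp (b + t) = ‖X‖ := by rw [htdef, add_sub_cancel, Real.exp_log hn]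
  have hq : (|t|, θ) ∈ profileCurve ε := by
    refine ⟨⟨abs_nonneg t, ht⟩, hθ, ?_⟩
    rw [shellFun, hz] at h0
    have h1 : Real.cosh (|t| / ε) = Real.cosh (t / ε) := by
      rw [← Real.cosh_abs (t / ε), abs_div, abs_of_pos hε]
    simp only [h1]
    have h2 : ‖X‖ * (ε ^ 2 * Real.cosh (t / ε) ^ 2 - (2 - 2 * Real.cos θ)) = 0 := by
      linear_combination h0
    linarith [(mul_eq_zero.1 h2).resolve_left hn.ne']
  have hmem : (|t| + θ, φ) ∈ halfShellDomain ε := ⟨⟨_, hq, rfl⟩, hφ⟩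
  rcases le_total 0 t with h | h
  · refine Or.inl ⟨_, hmem, ?_⟩
    rw [halfShellParam_eq hε hq, abs_of_nonneg h, one_mul, hexp, ← hXe]
  · refine Or.inr ⟨_, hmem, ?_⟩
    rw [halfShellParam_eq hε hq, abs_of_nonpos h, neg_one_mul, neg_neg, hexp, ← hXe]

/-- The area of the boundary of the shell is bounded in terms of its radius only. -/
theorem exists_surfaceMeasure_shell_le : ∃ K : ℝ, 0 ≤ K ∧ ∀ ε b : ℝ, 0 < ε → ε ≤ 1 →
    surfaceMeasure (shell ε b) Set.univ ≤ ENNReal.ofReal (K * Real.exp b ^ 2) := by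
  set c := Measure.addHaarScalarFactor (volume : Measure (EuclideanSpace ℝ (Fin 2)))
    (Measure.hausdorffMeasure (2 : ℕ)) with hc
  -- Each half has area factor 64 times the squared Lipschitz constant (2e^(b+4))², that is 256 e⁸
  -- e^(2b). There are two halves, and c normalises Hausdorff measure.
  refine ⟨c * (512 * Real.exp 4 ^ 2), by positivity, fun ε b hε hε1 => ?_⟩
  have hhalf : ∀ σ : ℝ, |σ| = 1 →
      Measure.hausdorffMeasure (2 : ℕ) (halfShellParam ε b σ '' halfShellDomain ε) ≤
        ENNReal.ofReal (256 * Real.exp 4 ^ 2 * Real.exp b ^ 2) := by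
    intro σ hσ
    refine ((lipschitzOnWith_halfShellParam (b := b) hε hσ).hausdorffMeasure_image_le
      (d := (2 : ℕ)) (by norm_num)).trans ?_
    have h64 := hausdorffMeasure_halfShellDomain_le ε
    have h64' : (64 : ℝ≥0∞) = ENNReal.ofReal 64 := by norm_num
    rw [ENNReal.rpow_natCast]
    push_cast
    refine (mul_le_mul_right h64 _).trans (le_of_eq ?_)
    change ENNReal.ofReal (2 * Real.exp (b + 4)) ^ 2 * 64 = _
    rw [h64', ← ENNReal.ofReal_pow (by positivity), ← ENNReal.ofReal_mul (by positivity),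
      Real.exp_add]
    congr 1
    ring
  rw [surfaceMeasure, Measure.restrict_apply_univ, Measure.euclideanHausdorffMeasure_def,
    Measure.smul_apply, ← hc]
  refine (mul_le_mul_right ((measure_mono (frontier_shell_subset_param hε hε1)).trans
    ((measure_union_le _ _).trans (add_le_add (hhalf 1 (by norm_num))
      (hhalf (-1) (by norm_num))))) (c : ℝ≥0∞)).trans (le_of_eq ?_)
  rw [← ENNReal.ofReal_add (by positivity) (by positivity), ← ENNReal.ofReal_coe_nnreal,
    ← ENNReal.ofReal_mul (by positivity)]
  congr 1
  ring

/-! ### Curvature norms of the comparison ball -/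

/-- The orthogonal projection to the horizontal plane. -/
noncomputable def horizontal (X : E3) : EuclideanSpace ℝ (Fin 2) := !₂[X 0, X 1]

theorem lipschitzWith_horizontal : LipschitzWith 1 horizontal := by
  refine LipschitzWith.of_dist_le_mul fun X Y => ?_
  rw [NNReal.coe_one, one_mul, EuclideanSpace.dist_eq, EuclideanSpace.dist_eq, Fin.sum_univ_two,
    Fin.sum_univ_three]
  exact Real.sqrt_le_sqrt (le_add_of_nonneg_right (sq_nonneg _))

theorem ball_subset_horizontal_image_sphere (R : ℝ) :
    ball (0 : EuclideanSpace ℝ (Fin 2)) R ⊆ horizontal '' sphere 0 R := by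
  intro y hy
  rw [mem_ball_zero_iff] at hy
  have hR : 0 ≤ R := (norm_nonneg y).trans hy.le
  have hsq : ‖y‖ ^ 2 = y 0 ^ 2 + y 1 ^ 2 := by
    rw [EuclideanSpace.norm_sq_eq, Fin.sum_univ_two]
    simp only [Real.norm_eq_abs, sq_abs]
  have hle : ‖y‖ ^ 2 ≤ R ^ 2 := by gcongr
  refine ⟨!₂[y 0, y 1, √(R ^ 2 - ‖y‖ ^ 2)], ?_, ?_⟩
  · rw [mem_sphere_zero_iff_norm, ← sq_eq_sq₀ (norm_nonneg _) hR, norm_sq_E3]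
    simp
    rw [Real.sq_sqrt (by linarith), hsq]
    ring
  · ext i
    fin_cases i <;> simp [horizontal]

/-- The sphere projects onto a set containing a disc by a 1-Lipschitz map, so it cannot be null.
Without this the curvature norm of the ball could vanish and its essential supremum be -∞. -/
theorem surfaceMeasure_ball_ne_zero {R : ℝ} (hR : 0 < R) : surfaceMeasure (ball 0 R) ≠ 0 := by
  have hfr : frontier (ball (0 : E3) R) = sphere 0 R := frontier_ball 0 hR.ne'
  intro h
  have h0 : (Measure.euclideanHausdorffMeasure 2 : Measure E3) (sphere 0 R) = 0 := by
    rw [← hfr]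
    exact Measure.restrict_eq_zero.1 h
  have h1 : (Measure.hausdorffMeasure (2 : ℕ) : Measure E3) (sphere 0 R) = 0 := by
    rw [Measure.euclideanHausdorffMeasure_def, Measure.smul_apply] at h0
    refine (smul_eq_zero.1 h0).resolve_left
      (Measure.addHaarScalarFactor_volume_hausdorffMeasure_ne_zero 2)
  have h2 := (lipschitzWith_horizontal.lipschitzOnWith (s := sphere 0 R)).hausdorffMeasure_image_le
    (d := (2 : ℕ)) (by norm_num)
  rw [h1, mul_zero] at h2
  have h3 : (volume : Measure (EuclideanSpace ℝ (Fin 2))) (ball 0 R) = 0 := by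
    refine measure_mono_null (ball_subset_horizontal_image_sphere R) ?_
    rw [← EuclideanSpace.euclideanHausdorffMeasure_eq_volume,
      Measure.euclideanHausdorffMeasure_def, Measure.smul_apply, le_zero_iff.1 h2, smul_zero]
  exact (measure_ball_pos volume 0 hR).ne' h3

theorem ae_meanCurvature_ball {R : ℝ} (hR : 0 < R) :
    ∀ᵐ X ∂surfaceMeasure (ball 0 R), meanCurvature (ball 0 R) X = 1 / R := by
  have hfr : frontier (ball (0 : E3) R) = sphere 0 R := frontier_ball 0 hR.ne'
  refine (ae_restrict_mem isClosed_frontier.measurableSet).mono fun X hX => ?_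
  exact meanCurvature_ball hR (hfr ▸ hX)

theorem normH_ball_pos {R : ℝ} (hR : 0 < R) {p : ℝ≥0∞} (hp : p ≠ 0) :
    0 < normH p (ball 0 R) := by
  rw [normH, eLpNorm_congr_ae (ae_meanCurvature_ball hR), pos_iff_ne_zero]
  intro h
  rw [eLpNorm_eq_zero_iff aestronglyMeasurable_const hp] at h
  have hR' : (1 / R : ℝ) ≠ 0 := by positivity
  have hFalse : ∀ᵐ _X ∂surfaceMeasure (ball 0 R), False := h.mono fun _ hx => hR' hx
  rw [eventually_false_iff_eq_bot, ae_eq_bot] at hFalse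
  exact surfaceMeasure_ball_ne_zero hR hFalse

theorem supH_ball {R : ℝ} (hR : 0 < R) : supH (ball 0 R) = ((1 / R : ℝ) : EReal) := by
  rw [supH, essSup_congr_ae (g := fun _ => ((1 / R : ℝ) : EReal))
    ((ae_meanCurvature_ball hR).mono fun X hX => by simp only [hX])]
  exact essSup_const _ (surfaceMeasure_ball_ne_zero hR)

/-! ### Curvature norms of the shells and conclusion -/

theorem abs_meanCurvature_shell_le_exp {ε b : ℝ} (hε : 0 < ε) (hε1 : ε ≤ 1) {X : E3}
    (hX : X ∈ frontier (shell ε b)) :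
    |meanCurvature (shell ε b) X| ≤ 2 * Real.exp 4 / Real.exp b := by
  obtain ⟨hX0, h0⟩ := frontier_shell_subset hε hε1 hX
  have hn : 0 < ‖X‖ := norm_pos_iff.2 hX0
  have ht := (abs_le.1 (abs_log_norm_sub_le_four hε hX0 h0.le)).1
  have hlow : Real.exp (b - 4) ≤ ‖X‖ := (Real.le_log_iff_exp_le hn).1 (by linarith)
  refine (abs_meanCurvature_shell_le hε hε1 (frontier_shell_subset hε hε1) hX).trans ?_
  calc 2 / ‖X‖ ≤ 2 / Real.exp (b - 4) := by gcongr
    _ = 2 * Real.exp 4 / Real.exp b := by rw [Real.exp_sub]; field_simp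

/-- The uniform curvature bound is multiplied by the area to the power 1/p. For p = ∞ the convention
`p.toReal⁻¹ = 0` makes the area factor 1, so one formula covers all exponents. -/
theorem normH_shell_le {K : ℝ} (hK : 0 ≤ K) {ε b : ℝ} (hε : 0 < ε) (hε1 : ε ≤ 1)
    (harea : surfaceMeasure (shell ε b) Set.univ ≤ ENNReal.ofReal (K * Real.exp b ^ 2))
    (p : ℝ≥0∞) :
    normH p (shell ε b) ≤ ENNReal.ofReal (K ^ p.toReal⁻¹ * (2 * Real.exp 4) *
      Real.exp b ^ (-(1 - 2 * p.toReal⁻¹))) := by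
  have hb := Real.exp_pos b
  have hbound : ∀ᵐ X ∂surfaceMeasure (shell ε b),
      ‖meanCurvature (shell ε b) X‖ ≤ 2 * Real.exp 4 / Real.exp b :=
    (ae_restrict_mem isClosed_frontier.measurableSet).mono fun X hX =>
      abs_meanCurvature_shell_le_exp hε hε1 hX
  have hq : 0 ≤ p.toReal⁻¹ := by positivity
  refine (eLpNorm_le_of_ae_bound hbound).trans ?_
  refine (mul_le_mul_left (ENNReal.rpow_le_rpow harea hq) _).trans (le_of_eq ?_)
  rw [ENNReal.ofReal_rpow_of_nonneg (by positivity) hq, ← ENNReal.ofReal_mul (by positivity)]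
  congr 1
  rw [Real.mul_rpow hK (by positivity), ← Real.rpow_natCast, ← Real.rpow_mul hb.le, neg_sub,
    Real.rpow_sub hb, Real.rpow_one]
  push_cast
  ring

/-- There are shells of unit volume with arbitrarily small curvature norm. -/
theorem exists_shell_normH_lt {p : ℝ≥0∞} (hp : 2 < p) {η : ℝ≥0∞} (hη : 0 < η) :
    ∃ ε b : ℝ, 0 < ε ∧ ε ≤ 1 ∧ volume (shell ε b) = 1 ∧ normH p (shell ε b) < η := by
  obtain ⟨K, hK, harea⟩ := exists_surfaceMeasure_shell_le
  -- This is where p > 2 enters: area growth e^(2b/p) is beaten by curvature decay e^(-b).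
  have hq : 0 < 1 - 2 * p.toReal⁻¹ := by
    rcases eq_or_ne p ⊤ with rfl | htop
    · simp
    · have h2 : 2 < p.toReal := by
        have := (ENNReal.toReal_lt_toReal (by norm_num) htop).2 hp
        simpa using this
      have : p.toReal⁻¹ < 2⁻¹ := by gcongr
      linarith
  have hlim : Tendsto (fun l : ℝ => ENNReal.ofReal (K ^ p.toReal⁻¹ * (2 * Real.exp 4) *
      l ^ (-(1 - 2 * p.toReal⁻¹)))) atTop (𝓝 0) := by
    have := ENNReal.tendsto_ofReal ((tendsto_rpow_neg_atTop hq).const_mul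
      (K ^ p.toReal⁻¹ * (2 * Real.exp 4)))
    rwa [mul_zero, ENNReal.ofReal_zero] at this
  obtain ⟨Λ, hΛ⟩ := eventually_atTop.1 (hlim.eventually (gt_mem_nhds hη))
  obtain ⟨ε, b, hε, hε1, hV, hb⟩ := exists_shell_volume_eq_one Λ
  exact ⟨ε, b, hε, hε1, hV, (normH_shell_le hK hε hε1 (harea ε b hε hε1) p).trans_lt (hΛ _ hb)⟩

theorem supH_shell_le {ε b : ℝ} (hε : 0 < ε) (hε1 : ε ≤ 1) :
    supH (shell ε b) ≤ ((2 * Real.exp 4 / Real.exp b : ℝ) : EReal) :=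
  essSup_le_of_ae_le _ ((ae_restrict_mem isClosed_frontier.measurableSet).mono fun _ hX =>
    EReal.coe_le_coe_iff.2 ((le_abs_self _).trans (abs_meanCurvature_shell_le_exp hε hε1 hX)))

theorem exists_ball_volume_eq_one : ∃ R > 0, volume (ball (0 : E3) R) = 1 := by
  have h0 : volume (ball (0 : E3) 1) ≠ 0 := (measure_ball_pos volume 0 one_pos).ne'
  have htop : volume (ball (0 : E3) 1) ≠ ⊤ := measure_ball_lt_top.ne
  set v := (volume (ball (0 : E3) 1)).toReal with hv
  have hv0 : 0 < v := ENNReal.toReal_pos h0 htop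
  refine ⟨v⁻¹ ^ (3⁻¹ : ℝ), by positivity, ?_⟩
  rw [Measure.addHaar_ball _ _ (by positivity), finrank_euclideanSpace_fin,
    ← ENNReal.ofReal_toReal htop, ← hv, ← ENNReal.ofReal_mul (by positivity), ← Real.rpow_natCast,
    ← Real.rpow_mul (by positivity)]
  norm_num
  rw [inv_mul_cancel₀ hv0.ne']

theorem corollary2 :
    (∀ p : ℝ≥0∞, 2 < p →
      sInf {a : ℝ≥0∞ | ∃ Ω : Set E3, IsC11BallDomain Ω ∧ volume Ω = 1 ∧ a = normH p Ω} = 0) ∧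
    (∀ p : ℝ≥0∞, 2 < p →
      ∃ Ω : Set E3, IsC11BallDomain Ω ∧
        ∃ R > 0, volume (ball (0 : E3) R) = volume Ω ∧ normH p Ω < normH p (ball (0 : E3) R)) ∧
    (∃ Ω : Set E3, IsC11BallDomain Ω ∧
      Bornology.IsBounded Ω ∧ IsConnected Ω ∧ IsConnected (frontier Ω) ∧
        ∃ R > 0, volume (ball (0 : E3) R) = volume Ω ∧ supH Ω < supH (ball (0 : E3) R)) := by

  obtain ⟨R, hR, hVR⟩ := exists_ball_volume_eq_one
  refine ⟨fun p hp => ?_, fun p hp => ?_, ?_⟩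
  · refine le_antisymm (le_of_forall_gt fun η hη => ?_) zero_le
    obtain ⟨ε, b, hε, hε1, hV, hlt⟩ := exists_shell_normH_lt hp hη
    refine lt_of_le_of_lt (sInf_le ?_) hlt
    exact ⟨shell ε b, isC11BallDomain_shell hε hε1, hV, rfl⟩
  · obtain ⟨ε, b, hε, hε1, hV, hlt⟩ :=
      exists_shell_normH_lt hp (normH_ball_pos hR (zero_le.trans_lt hp).ne')
    exact ⟨shell ε b, isC11BallDomain_shell hε hε1, R, hR, hVR.trans hV.symm, hlt⟩
  · obtain ⟨ε, b, hε, hε1, hV, hb⟩ := exists_shell_volume_eq_one (2 * Real.exp 4 * R + 1)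
    refine ⟨shell ε b, isC11BallDomain_shell hε hε1, isBounded_shell hε hε1,
      isConnected_shell hε hε1, isConnected_frontier_shell hε hε1, R, hR, hVR.trans hV.symm,
      (supH_shell_le hε hε1).trans_lt ?_⟩
    rw [supH_ball hR, EReal.coe_lt_coe_iff, div_lt_div_iff₀ (Real.exp_pos b) hR]
    linarith
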